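/- Let $\mathbb N^\times$ be the multiplicative monoid of positive integers, viewed as a category with one object $\bullet$, and let $\mathcal R$ be the small category whose objects are the integers $a>0$, with exactly one morphism $f(a,b):a\to b$ if $b\mid a$ and no morphism $a\to b$ otherwise. For a small category $\mathcal C$ let $\widehat{\mathcal C}$ be the topos of contravariant functors $\mathcal C\to\mathrm{Sets}$, let $y$ be the Yoneda embedding, and let the category of points of $\widehat{\mathcal C}$ be that of geometric morphisms $p:\mathrm{Sets}\to\widehat{\mathcal C}$, with the natural transformations of inverse images $p^*\to q^*$ as morphisms. The functor $\rho:\mathcal R\to\mathbb N^\times$, $\rho(f(a,b))=a/b$, induces a geometric morphism $\widehat{\mathcal R}\to\widehat{\mathbb N^\times}$ whose inverse image is $Z\mapsto Z\circ\rho$, and composition with it gives a functor $\rho_*$ from the points of $\widehat{\mathcal R}$ to the points of $\widehat{\mathbb N^\times}$. Let $\mathbb A^f_{\mathbb Q}$ be the ring of finite adeles of $\mathbb Q$, $\hat{\mathbb Z}\subset\mathbb A^f_{\mathbb Q}$ the profinite integers, and put $H_a=\{q\in\mathbb Q\mid qa\in\hat{\mathbb Z}\}$ for $a\in\mathbb A^f_{\mathbb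 Q}$. Then the points are identified as follows. (1) There is an equivalence $p\mapsto H(p)$ from the category of points of $\widehat{\mathcal R}$ to the category of subgroups $\mathbb Z\subset H\subset\mathbb Q$ with inclusions as morphisms, such that for every integer $n>0$ one has $\frac1n\in H(p)$ if and only if $p^*(y(n))\neq\emptyset$. There is a bijection from the set of isomorphism classes of points of $\widehat{\mathcal R}$ to the subset $\hat{\mathbb Z}/\hat{\mathbb Z}^*\subset\mathbb A^f_{\mathbb Q}/\hat{\mathbb Z}^*$, which sends $p$ to the class of $a$ if and only if $H(p)=H_a$. (2) There is an equivalence $p\mapsto G(p)$ from the category of points of $\widehat{\mathbb N^\times}$ to the category of totally ordered groups isomorphic to a nontrivial subgroup of $\mathbb Q$, with injective homomorphisms of ordered groups as morphisms, such that $p^*(y(\bullet))$ with its action of $\mathbb N^\times$ is, naturally in $p$, the set of strictly positive elements of $G(p)$ on which $\mathbb N^\times$ acts by multiplication. There is a bijection from the set of isomorphism classes of points of $\widehat{\mathbb N^\times}$ to $\mathbb Q_+^\times\backslash\mathbb A^f_{\mathbb Q}/\hat{\mathbb Z}^*$, which sends $p$ to the class of $a$ if and only if $G(p)$ and $H_a$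 are isomorphic as ordered groups. Under these identifications the geometric morphism acts on points as follows. (3) The functor $\rho_*$ sends a subgroup $\mathbb Z\subset H\subset\mathbb Q$ to $H$ viewed as an abstract ordered group: the functors $p\mapsto G(\rho_*p)$ and $p\mapsto H(p)$, the latter with values in ordered groups, are naturally isomorphic. (4) On isomorphism classes of points, $\rho_*$ is the restriction to $\hat{\mathbb Z}/\hat{\mathbb Z}^*\subset\mathbb A^f_{\mathbb Q}/\hat{\mathbb Z}^*$ of the quotient map $\mathbb A^f_{\mathbb Q}/\hat{\mathbb Z}^*\to\mathbb Q_+^\times\backslash\mathbb A^f_{\mathbb Q}/\hat{\mathbb Z}^*$. -/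

import Mathlib

open CategoryTheory

/-- A geometric morphism `E → F`: an adjunction between the inverse image `F ⥤ E` and the direct
image `E ⥤ F` whose left adjoint, the inverse image, preserves finite limits. -/
structure GeomMorphism (E : Type*) [Category* E] (F : Type*) [Category* F] where
  /-- the direct image functor -/
  direct : E ⥤ F
  /-- the inverse image functor -/
  inverse : F ⥤ E
  /-- the adjunction -/
  adj : inverse ⊣ direct
  /-- left exactness of the inverse image -/
  lex : Limits.PreservesFiniteLimits inverse

namespace GeomMorphism

/-- Morphisms of geometric morphisms are the natural transformations of inverse images. -/
instance instCategory (E : Type*) [Category* E] (F : Type*) [Category* F] :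
    Category (GeomMorphism E F) where
  Hom f g := f.inverse ⟶ g.inverse
  id f := 𝟙 f.inverse
  comp α β := NatTrans.vcomp α β

/-- Composition of geometric morphisms. -/
def comp {E F G : Type*} [Category* E] [Category* F] [Category* G]
    (f : GeomMorphism E F) (g : GeomMorphism F G) : GeomMorphism E G where
  direct := f.direct ⋙ g.direct
  inverse := g.inverse ⋙ f.inverse
  adj := g.adj.comp f.adj
  lex := by
    have := f.lex
    have := g.lex
    infer_instance

/-- Composition with `g : F → G`, as a functor in the first geometric morphism. -/
def postcomp (E : Type*) [Category* E] {F G : Type*} [Category* F] [Category* G]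
    (g : GeomMorphism F G) : GeomMorphism E F ⥤ GeomMorphism E G where
  obj f := f.comp g
  map {f f'} α :=
    (Functor.whiskerLeft g.inverse (α : f.inverse ⟶ f'.inverse) :
      g.inverse ⋙ f.inverse ⟶ g.inverse ⋙ f'.inverse)

end GeomMorphism

/-- The presheaf topos on a small category: contravariant functors to sets. -/
abbrev PresheafTopos (C : Type) [SmallCategory C] : Type 1 := Cᵒᵖ ⥤ Type

/-- The geometric morphism between presheaf toposes induced by a functor `F : C ⥤ D`: its inverse
image is the restriction along `F`, its direct image the right Kan extension along `F`. -/
noncomputable def presheafGeomMorphism {C D : Type} [SmallCategory C] [SmallCategory D]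
    (F : C ⥤ D) : GeomMorphism (PresheafTopos C) (PresheafTopos D) where
  direct := F.op.ran
  inverse := (Functor.whiskeringLeft _ _ (Type)).obj F.op
  adj := F.op.ranAdjunction (Type)
  lex := inferInstance

/-- The category of points of the presheaf topos on `C`: geometric morphisms from the topos of
sets. -/
abbrev PresheafPoint (C : Type) [SmallCategory C] : Type 1 :=
  GeomMorphism (Type) (PresheafTopos C)

/-- The covariant functor `C ⥤ Type` associated with a point `p`: it sends `c` to the value of the
inverse image `p^*` on the presheaf represented by `c`. -/
def pointFiber (C : Type) [SmallCategory C] : PresheafPoint C ⥤ (C ⥤ Type) where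
  obj p := yoneda ⋙ p.inverse
  map {p q} α := Functor.whiskerLeft yoneda (α : p.inverse ⟶ q.inverse)

/-- The small category `𝓡`: one object for each integer `a > 0`, and a single morphism
`f(a, b) : a ⟶ b` if `b ∣ a`, no morphism otherwise. -/
structure CatR : Type where
  /-- the integer labelling the object -/
  val : ℕ+

instance CatR.instSmallCategory : SmallCategory CatR where
  Hom a b := PLift (b.val ∣ a.val)
  id a := ⟨dvd_refl a.val⟩
  comp f g := ⟨dvd_trans g.down f.down⟩

/-- The multiplicative monoid `ℕ^×` of positive integers, as a category with one object. -/
abbrev CatN : Type := SingleObj ℕ+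

/-- The functor `ρ : 𝓡 ⥤ ℕ^×` which sends `f(a, b)` to the integer `a / b`. -/
def rho : CatR ⥤ CatN where
  obj _ := SingleObj.star ℕ+
  map {a b} _ := (PNat.divExact a.val b.val : ℕ+)
  map_id a := by
    change PNat.divExact a.val a.val = 1
    exact mul_left_cancel ((PNat.mul_div_exact (dvd_refl a.val)).trans (mul_one _).symm)
  map_comp {a b c} f g := by
    change PNat.divExact a.val c.val = PNat.divExact b.val c.val * PNat.divExact a.val b.val
    apply mul_left_cancel (a := c.val)
    rw [PNat.mul_div_exact (dvd_trans g.down f.down), ← mul_assoc, PNat.mul_div_exact g.down,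
      PNat.mul_div_exact f.down]

/-- The category of subgroups `H` with `ℤ ⊂ H ⊂ ℚ`, with inclusions as morphisms. -/
abbrev SubgroupOverZ : Type := {H : AddSubgroup ℚ // (Int.castAddHom ℚ).range ≤ H}

/-- Totally ordered abelian groups isomorphic to a nontrivial subgroup of `ℚ`. -/
structure RatOrdGroup : Type 1 where
  /-- the underlying set -/
  carrier : Type
  [addCommGroup : AddCommGroup carrier]
  [linearOrder : LinearOrder carrier]
  [isOrderedAddMonoid : IsOrderedAddMonoid carrier]
  exists_iso : ∃ K : AddSubgroup ℚ, K ≠ ⊥ ∧ Nonempty (carrier ≃+o K)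

namespace RatOrdGroup

attribute [instance] addCommGroup linearOrder isOrderedAddMonoid

/-- Morphisms are the injective homomorphisms of ordered groups. -/
instance instCategory : Category RatOrdGroup where
  Hom A B := {f : A.carrier →+o B.carrier // Function.Injective f}
  id A := ⟨OrderAddMonoidHom.id A.carrier, Function.injective_id⟩
  comp f g := ⟨g.1.comp f.1, g.2.comp f.2⟩

theorem smul_pos_of_pos (A : RatOrdGroup) (n : ℕ+) {x : A.carrier} (hx : 0 < x) :
    0 < (n : ℕ) • x :=
  nsmul_pos hx n.pos.ne'

theorem map_pos {A B : RatOrdGroup} (f : A ⟶ B) {x : A.carrier} (hx : 0 < x) : 0 < f.1 x :=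
  lt_of_le_of_ne (by simpa using f.1.monotone' hx.le) fun h =>
    hx.ne (f.2 ((map_zero f.1).trans h))

/-- The functor which sends an ordered group to the set of its strictly positive elements, on
which `ℕ^×` acts by multiplication. -/
def positivePart : RatOrdGroup ⥤ (CatN ⥤ Type) where
  obj A :=
    { obj := fun _ => {x : A.carrier // 0 < x}
      map := fun n => TypeCat.ofHom fun x =>
        ⟨((n : ℕ+) : ℕ) • x.1, A.smul_pos_of_pos n x.2⟩
      map_id := fun _ => by
        ext x
        exact one_nsmul x.1
      map_comp := fun m n => by
        ext x
        exact mul_nsmul' x.1 ((n : ℕ+) : ℕ) ((m : ℕ+) : ℕ) }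
  map f :=
    { app := fun _ => TypeCat.ofHom fun x => ⟨f.1 x.1, map_pos f x.2⟩
      naturality := fun _ _ n => by
        ext x
        exact map_nsmul f.1 ((n : ℕ+) : ℕ) x.1 }

end RatOrdGroup

theorem SubgroupOverZ.ne_bot (H : SubgroupOverZ) : H.1 ≠ ⊥ := fun h => by
  have h1 : (1 : ℚ) ∈ H.1 := H.2 ⟨1, by simp⟩
  rw [h] at h1
  exact one_ne_zero (AddSubgroup.mem_bot.1 h1)

/-- The functor which sends a subgroup `ℤ ⊂ H ⊂ ℚ` to `H` viewed as an abstract ordered group. -/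
def SubgroupOverZ.toRatOrdGroup : SubgroupOverZ ⥤ RatOrdGroup where
  obj H := { carrier := H.1, exists_iso := ⟨H.1, H.ne_bot, ⟨OrderAddMonoidIso.refl _⟩⟩ }
  map {H K} i :=
    ⟨{ AddSubgroup.inclusion (leOfHom i) with monotone' := fun _ _ h => h },
      AddSubgroup.inclusion_injective (leOfHom i)⟩

/-- The ring `𝔸_ℚ^f` of finite adeles of `ℚ`. -/
abbrev FinAdele : Type := IsDedekindDomain.FiniteAdeleRing ℤ ℚ

/-- The ring `Ẑ` of profinite integers: the finite adeles which are integral at every prime. -/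
noncomputable def zHat : Subring FinAdele where
  carrier := {a | ∀ v, a v ∈ v.adicCompletionIntegers ℚ}
  zero_mem' := fun v => (v.adicCompletionIntegers ℚ).zero_mem
  one_mem' := fun v => (v.adicCompletionIntegers ℚ).one_mem
  add_mem' := fun ha hb v => (v.adicCompletionIntegers ℚ).add_mem _ _ (ha v) (hb v)
  mul_mem' := fun ha hb v => (v.adicCompletionIntegers ℚ).mul_mem _ _ (ha v) (hb v)
  neg_mem' := fun ha v => (v.adicCompletionIntegers ℚ).neg_mem _ (ha v)

/-- The group `Ẑ^*` of units of `Ẑ`, inside the finite ideles. -/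
noncomputable def zHatUnits : Subgroup FinAdeleˣ := zHat.toSubmonoid.units

/-- The group `ℚ_+^×` of positive rational numbers, inside the finite ideles. -/
noncomputable def posRat : Subgroup FinAdeleˣ :=
  (Units.posSubgroup ℚ).map (IsDedekindDomain.FiniteAdeleRing.unitEmbedding ℤ ℚ)

/-- The quotient `𝔸_ℚ^f / Ẑ^*`. -/
abbrev AdeleModUnits : Type := MulAction.orbitRel.Quotient zHatUnits FinAdele

/-- The double quotient `ℚ_+^× \ 𝔸_ℚ^f / Ẑ^*`. -/
abbrev AdeleClass : Type :=
  MulAction.orbitRel.Quotient (posRat ⊔ zHatUnits : Subgroup FinAdeleˣ) FinAdele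

/-- The class in `𝔸_ℚ^f / Ẑ^*` of a finite adele. -/
noncomputable def toAdeleModUnits (a : FinAdele) : AdeleModUnits := Quotient.mk'' a

/-- The class in `ℚ_+^× \ 𝔸_ℚ^f / Ẑ^*` of a finite adele. -/
noncomputable def toAdeleClass (a : FinAdele) : AdeleClass := Quotient.mk'' a

/-- The quotient map `𝔸_ℚ^f / Ẑ^* → ℚ_+^× \ 𝔸_ℚ^f / Ẑ^*`. -/
noncomputable def quotMap : AdeleModUnits → AdeleClass :=
  Quotient.map' id fun _ _ ⟨u, hu⟩ => ⟨⟨u.1, Subgroup.mem_sup_right u.2⟩, hu⟩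

/-- The subset `Ẑ / Ẑ^*` of `𝔸_ℚ^f / Ẑ^*`. -/
noncomputable def zHatModUnits : Set AdeleModUnits := toAdeleModUnits '' (zHat : Set FinAdele)

/-- The subgroup `H_a = {q ∈ ℚ | q a ∈ Ẑ}` of `ℚ` parametrized by a finite adele `a`. -/
noncomputable def adeleSubgroup (a : FinAdele) : AddSubgroup ℚ :=
  zHat.toAddSubgroup.comap
    ((AddMonoidHom.mulRight a).comp (algebraMap ℚ FinAdele).toAddMonoidHom)

/-- The set of isomorphism classes of points of the presheaf topos on `C`. -/
abbrev PointClass (C : Type) [SmallCategory C] : Type 1 :=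
  Quotient (isIsomorphicSetoid (PresheafPoint C))

/-- The isomorphism class of a point. -/
def PresheafPoint.cls {C : Type} [SmallCategory C] (p : PresheafPoint C) : PointClass C :=
  Quotient.mk _ p

section

open Limits Opposite

namespace PresheafPoint

variable {C : Type} [SmallCategory C]

/-- Every element of the inverse image of a presheaf comes from a representable presheaf. -/
theorem exists_map_eq (p : PresheafPoint C) {P : PresheafTopos C} (x : p.inverse.obj P) :
    ∃ (c : C) (s : yoneda.obj c ⟶ P) (z : p.inverse.obj (yoneda.obj c)),
      p.inverse.map s z = x := by
  have := p.adj.leftAdjoint_preservesColimits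
  obtain ⟨j, z, hz⟩ := Types.jointly_surjective_of_isColimit
    (isColimitOfPreserves p.inverse (Presheaf.isColimitTautologicalCocone P)) x
  exact ⟨j.left, j.hom, z, hz⟩

theorem isCofiltered_elements_inverse (p : PresheafPoint C) : IsCofiltered p.inverse.Elements := by
  have := p.lex
  exact Functor.isCofiltered_elements p.inverse

theorem map_comp_apply (p : PresheafPoint C) {P Q R : PresheafTopos C} (f : P ⟶ Q) (g : Q ⟶ R)
    (x : p.inverse.obj P) : p.inverse.map (f ≫ g) x = p.inverse.map g (p.inverse.map f x) := by
  rw [p.inverse.map_comp]; rfl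

/-- Two elements coming from representable presheaves which become equal in the inverse image of
a presheaf `P` are equal for a reason that is visible in some representable presheaf. -/
theorem exists_of_map_eq (p : PresheafPoint C) {P : PresheafTopos C} {c d : C}
    (s : yoneda.obj c ⟶ P) (t : yoneda.obj d ⟶ P) (z : p.inverse.obj (yoneda.obj c))
    (w : p.inverse.obj (yoneda.obj d)) (h : p.inverse.map s z = p.inverse.map t w) :
    ∃ (e : C) (u : e ⟶ c) (v : e ⟶ d) (y : p.inverse.obj (yoneda.obj e)),
      yoneda.map u ≫ s = yoneda.map v ≫ t ∧ p.inverse.map (yoneda.map u) y = z ∧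
        p.inverse.map (yoneda.map v) y = w := by
  have := p.isCofiltered_elements_inverse
  let A : p.inverse.Elements := ⟨yoneda.obj c, z⟩
  let B : p.inverse.Elements := ⟨yoneda.obj d, w⟩
  let X : p.inverse.Elements := ⟨P, p.inverse.map s z⟩
  obtain ⟨⟨W, x⟩, f, g, hfg⟩ := IsCofiltered.cospan (C := p.inverse.Elements)
    (CategoryOfElements.homMk A X s rfl) (CategoryOfElements.homMk B X t h.symm)
  obtain ⟨e, r, y, rfl⟩ := p.exists_map_eq x
  refine ⟨e, yoneda.preimage (r ≫ f.1), yoneda.preimage (r ≫ g.1), y, ?_, ?_, ?_⟩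
  · have hfg' : f.1 ≫ s = g.1 ≫ t := congr_arg Subtype.val hfg
    simp [hfg']
  · rw [yoneda.map_preimage, map_comp_apply]
    exact f.2
  · rw [yoneda.map_preimage, map_comp_apply]
    exact g.2

/-- The fiber functor of a point is flat. -/
instance isCofiltered_elements_pointFiber (p : PresheafPoint C) :
    IsCofiltered ((pointFiber C).obj p).Elements := by
  have := p.isCofiltered_elements_inverse
  have key (c d : C) (z : p.inverse.obj (yoneda.obj c)) (w : p.inverse.obj (yoneda.obj d)) :
      ∃ (e : C) (u : e ⟶ c) (v : e ⟶ d) (y : p.inverse.obj (yoneda.obj e)),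
        p.inverse.map (yoneda.map u) y = z ∧ p.inverse.map (yoneda.map v) y = w := by
    obtain ⟨⟨W, x⟩, f, g, -⟩ := IsCofilteredOrEmpty.cone_objs (C := p.inverse.Elements)
      ⟨yoneda.obj c, z⟩ ⟨yoneda.obj d, w⟩
    obtain ⟨e, r, y, rfl⟩ := p.exists_map_eq x
    refine ⟨e, yoneda.preimage (r ≫ f.1), yoneda.preimage (r ≫ g.1), y, ?_, ?_⟩
    · rw [yoneda.map_preimage, map_comp_apply]
      exact f.2
    · rw [yoneda.map_preimage, map_comp_apply]
      exact g.2
  refine { cone_objs := ?_, cone_maps := ?_, nonempty := ?_ }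
  · rintro ⟨c, z⟩ ⟨d, w⟩
    obtain ⟨e, u, v, y, hu, hv⟩ := key c d z w
    exact ⟨⟨e, y⟩, ⟨u, hu⟩, ⟨v, hv⟩, trivial⟩
  · rintro ⟨c, z⟩ ⟨d, w⟩ ⟨f, hf⟩ ⟨g, hg⟩
    let A : p.inverse.Elements := ⟨yoneda.obj c, z⟩
    let B : p.inverse.Elements := ⟨yoneda.obj d, w⟩
    obtain ⟨⟨W, x⟩, h, hh⟩ := IsCofilteredOrEmpty.cone_maps (C := p.inverse.Elements)
      (CategoryOfElements.homMk A B (yoneda.map f) hf)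
      (CategoryOfElements.homMk A B (yoneda.map g) hg)
    obtain ⟨e, r, y, rfl⟩ := p.exists_map_eq x
    refine ⟨⟨e, y⟩, ⟨yoneda.preimage (r ≫ h.1), ?_⟩, ?_⟩
    · change p.inverse.map (yoneda.map _) y = z
      rw [yoneda.map_preimage, map_comp_apply]
      exact h.2
    · apply Subtype.ext
      apply yoneda.map_injective
      have hh' : h.1 ≫ yoneda.map f = h.1 ≫ yoneda.map g := congr_arg Subtype.val hh
      change yoneda.map (yoneda.preimage (r ≫ h.1) ≫ f) =
        yoneda.map (yoneda.preimage (r ≫ h.1) ≫ g)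
      simp [hh']
  · obtain ⟨⟨W, x⟩⟩ := IsCofiltered.nonempty (C := p.inverse.Elements)
    obtain ⟨e, r, y, rfl⟩ := p.exists_map_eq x
    exact ⟨⟨e, y⟩⟩

section Full

variable {p q : PresheafPoint C} (φ : (pointFiber C).obj p ⟶ (pointFiber C).obj q)

/-- The extension to all presheaves of a transformation of fiber functors. -/
noncomputable def homExtend (P : PresheafTopos C) (x : p.inverse.obj P) : q.inverse.obj P :=
  q.inverse.map (p.exists_map_eq x).choose_spec.choose
    (φ.app _ (p.exists_map_eq x).choose_spec.choose_spec.choose)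

theorem map_app_congr {P : PresheafTopos C} {c d : C}
    (s : yoneda.obj c ⟶ P) (t : yoneda.obj d ⟶ P) (z : p.inverse.obj (yoneda.obj c))
    (w : p.inverse.obj (yoneda.obj d)) (h : p.inverse.map s z = p.inverse.map t w) :
    q.inverse.map s (φ.app c z) = q.inverse.map t (φ.app d w) := by
  obtain ⟨e, u, v, y, huv, rfl, rfl⟩ := p.exists_of_map_eq s t z w h
  have hu : φ.app c (p.inverse.map (yoneda.map u) y) =
      q.inverse.map (yoneda.map u) (φ.app e y) := NatTrans.naturality_apply φ u y
  have hv : φ.app d (p.inverse.map (yoneda.map v) y) =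
      q.inverse.map (yoneda.map v) (φ.app e y) := NatTrans.naturality_apply φ v y
  rw [hu, hv]
  refine (q.map_comp_apply (yoneda.map u) s _).symm.trans
    (Eq.trans ?_ (q.map_comp_apply (yoneda.map v) t _))
  rw [huv]

theorem homExtend_map {P : PresheafTopos C} {c : C} (s : yoneda.obj c ⟶ P)
    (z : p.inverse.obj (yoneda.obj c)) :
    homExtend φ P (p.inverse.map s z) = q.inverse.map s (φ.app c z) :=
  map_app_congr φ _ _ _ _ (p.exists_map_eq (p.inverse.map s z)).choose_spec.choose_spec.choose_spec

end Full

instance pointFiber_full : (pointFiber C).Full where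
  map_surjective {p q} φ := by
    refine ⟨({ app := fun P => TypeCat.ofHom (homExtend φ P), naturality := ?_ } :
      p.inverse ⟶ q.inverse), ?_⟩
    · intro P Q f
      ext x
      obtain ⟨c, s, z, rfl⟩ := p.exists_map_eq x
      change homExtend φ Q (p.inverse.map f (p.inverse.map s z)) =
        q.inverse.map f (homExtend φ P (p.inverse.map s z))
      rw [← map_comp_apply, homExtend_map, homExtend_map]
      exact q.map_comp_apply s f _
    · ext c z
      change homExtend φ _ z = φ.app c z
      have := homExtend_map φ (𝟙 (yoneda.obj c)) z
      rwa [p.inverse.map_id, q.inverse.map_id] at this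

instance pointFiber_faithful : (pointFiber C).Faithful where
  map_injective {p q} α β h := by
    apply NatTrans.ext
    ext P x
    obtain ⟨c, s, z, rfl⟩ := p.exists_map_eq x
    have hα : α.app P (p.inverse.map s z) = q.inverse.map s (α.app _ z) :=
      NatTrans.naturality_apply α s z
    have hβ : β.app P (p.inverse.map s z) = q.inverse.map s (β.app _ z) :=
      NatTrans.naturality_apply β s z
    refine hα.trans (Eq.trans ?_ hβ.symm)
    exact congr_arg (q.inverse.map s) (ConcreteCategory.congr_hom (NatTrans.congr_app h c) z)

/-- A flat functor is the fiber functor of a point. -/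
theorem exists_pointFiber_iso (F : C ⥤ Type) [IsCofiltered F.Elements] :
    ∃ p : PresheafPoint C, Nonempty ((pointFiber C).obj p ≅ F) := by
  let Φ : GrothendieckTopology.Point.{0} (⊥ : GrothendieckTopology C) :=
    { fiber := F
      initiallySmall := initiallySmall_of_essentiallySmall _
      jointly_surjective := by
        intro X R hR x
        obtain rfl : R = ⊤ := by simpa using hR
        exact ⟨X, 𝟙 _, trivial, x, by simp⟩ }
  let G : PresheafTopos C ⥤ Type := Φ.presheafFiber
  have : G.IsLeftAdjoint := Presheaf.isLeftAdjoint_of_preservesColimits.{0} G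
  refine ⟨⟨G.rightAdjoint, G, Adjunction.ofIsLeftAdjoint G, inferInstance⟩, ⟨?_⟩⟩
  exact Functor.isoWhiskerRight shrinkYonedaIsoYoneda.symm G ≪≫
    Φ.shrinkYonedaCompPresheafFiberIso

end PresheafPoint

end

namespace CatR

instance (c d : CatR) : Subsingleton (c ⟶ d) :=
  inferInstanceAs (Subsingleton (PLift (d.val ∣ c.val)))

variable (F : CatR ⥤ Type)

theorem nonempty_of_dvd {m n : ℕ+} (h : m ∣ n) (hn : Nonempty (F.obj ⟨n⟩)) :
    Nonempty (F.obj ⟨m⟩) :=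
  hn.map (F.map (⟨h⟩ : (⟨n⟩ : CatR) ⟶ ⟨m⟩))

variable [IsCofiltered F.Elements]

theorem exists_dvd_dvd_nonempty {m n : ℕ+} (hm : Nonempty (F.obj ⟨m⟩))
    (hn : Nonempty (F.obj ⟨n⟩)) : ∃ k : ℕ+, m ∣ k ∧ n ∣ k ∧ Nonempty (F.obj ⟨k⟩) := by
  obtain ⟨x⟩ := hm
  obtain ⟨y⟩ := hn
  obtain ⟨⟨c, z⟩, f, g, -⟩ := IsCofilteredOrEmpty.cone_objs (C := F.Elements) ⟨⟨m⟩, x⟩ ⟨⟨n⟩, y⟩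
  exact ⟨c.val, f.1.down, g.1.down, ⟨z⟩⟩

theorem nonempty_one : Nonempty (F.obj ⟨1⟩) := by
  obtain ⟨⟨c, z⟩⟩ := IsCofiltered.nonempty (C := F.Elements)
  exact nonempty_of_dvd F (one_dvd c.val) ⟨z⟩

theorem subsingleton_obj (c : CatR) : Subsingleton (F.obj c) where
  allEq x y := by
    obtain ⟨⟨d, z⟩, f, g, -⟩ := IsCofilteredOrEmpty.cone_objs (C := F.Elements) ⟨c, x⟩ ⟨c, y⟩
    have hf : F.map f.1 z = x := f.2
    have hg : F.map g.1 z = y := g.2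
    rw [← hf, ← hg, Subsingleton.elim f.1 g.1]

/-- The subgroup of `ℚ` attached to a flat functor on `𝓡`: the fractions whose denominator has a
nonempty fiber. -/
def subgroupOfFlat : SubgroupOverZ where
  val :=
    { carrier := {q | Nonempty (F.obj ⟨q.pnatDen⟩)}
      zero_mem' := nonempty_one F
      add_mem' := by
        intro a b ha hb
        obtain ⟨k, hak, hbk, hk⟩ := exists_dvd_dvd_nonempty F ha hb
        refine nonempty_of_dvd F (PNat.dvd_iff.2 ?_) hk
        exact (Rat.add_den_dvd_lcm a b).trans
          (Nat.lcm_dvd (PNat.dvd_iff.1 hak) (PNat.dvd_iff.1 hbk))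
      neg_mem' := by
        intro a ha
        refine nonempty_of_dvd F (PNat.dvd_iff.2 ?_) ha
        simp }
  property := by
    rintro _ ⟨k, rfl⟩
    exact nonempty_of_dvd F (PNat.dvd_iff.2 (by simp)) (nonempty_one F)

theorem mem_subgroupOfFlat_iff {q : ℚ} :
    q ∈ (subgroupOfFlat F).1 ↔ Nonempty (F.obj ⟨q.pnatDen⟩) := Iff.rfl

theorem one_div_mem_subgroupOfFlat_iff (n : ℕ+) :
    (1 / (n : ℚ)) ∈ (subgroupOfFlat F).1 ↔ Nonempty (F.obj ⟨n⟩) := by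
  rw [mem_subgroupOfFlat_iff]
  have : (1 / (n : ℚ)).pnatDen = n := PNat.eq (by simp)
  rw [this]

end CatR

/-- The functor sending a point of the presheaf topos on `𝓡` to a subgroup `ℤ ⊂ H ⊂ ℚ`. -/
def pointSubgroup : PresheafPoint CatR ⥤ SubgroupOverZ where
  obj p := CatR.subgroupOfFlat ((pointFiber CatR).obj p)
  map {p q} α := homOfLE fun _ hx => hx.map (((pointFiber CatR).map α).app _)

instance : pointSubgroup.Faithful where
  map_injective {p q} α β _ := by
    apply (pointFiber CatR).map_injective
    ext c x
    have := CatR.subsingleton_obj ((pointFiber CatR).obj q) c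
    exact Subsingleton.elim _ _

instance : pointSubgroup.Full where
  map_surjective {p q} i := by
    have h (c : CatR) (x : ((pointFiber CatR).obj p).obj c) :
        Nonempty (((pointFiber CatR).obj q).obj c) :=
      (CatR.one_div_mem_subgroupOfFlat_iff _ c.val).1
        (leOfHom i ((CatR.one_div_mem_subgroupOfFlat_iff _ c.val).2 ⟨x⟩))
    refine ⟨(pointFiber CatR).preimage
      { app := fun c => TypeCat.ofHom fun x => (h c x).some, naturality := ?_ }, rfl⟩
    intro c d f
    ext x
    have := CatR.subsingleton_obj ((pointFiber CatR).obj q) d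
    exact Subsingleton.elim _ _

namespace SubgroupOverZ

variable (H : SubgroupOverZ)

/-- The functor on `𝓡` attached to a subgroup `ℤ ⊂ H ⊂ ℚ`. -/
def toFunctor : CatR ⥤ Type where
  obj c := PLift ((1 / (c.val : ℚ)) ∈ H.1)
  map {c d} f := TypeCat.ofHom fun x => ⟨by
    obtain ⟨k, hk⟩ := f.down
    have : (1 / (d.val : ℚ)) = (k : ℕ) • (1 / (c.val : ℚ)) := by
      rw [hk]; push_cast; simp
    rw [this]
    exact H.1.nsmul_mem x.down _⟩

theorem one_div_lcm_mem {m n : ℕ+} (hm : (1 / (m : ℚ)) ∈ H.1) (hn : (1 / (n : ℚ)) ∈ H.1) :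
    (1 / ((PNat.lcm m n : ℕ+) : ℚ)) ∈ H.1 := by
  have h1 : ((m : ℕ).gcd n : ℚ) = m * (m : ℕ).gcdA n + n * (m : ℕ).gcdB n := by
    exact_mod_cast Nat.gcd_eq_gcd_ab (m : ℕ) n
  have h2 : ((m : ℕ).gcd n : ℚ) * ((PNat.lcm m n : ℕ+) : ℚ) = m * n := by
    rw [PNat.lcm_coe]
    exact_mod_cast Nat.gcd_mul_lcm (m : ℕ) n
  have hm0 : (m : ℚ) ≠ 0 := by positivity
  have hn0 : (n : ℚ) ≠ 0 := by positivity
  have hl0 : ((PNat.lcm m n : ℕ+) : ℚ) ≠ 0 := by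
    exact_mod_cast (PNat.lcm m n).ne_zero
  have : (1 / ((PNat.lcm m n : ℕ+) : ℚ)) =
      (m : ℕ).gcdA n • (1 / (n : ℚ)) + (m : ℕ).gcdB n • (1 / (m : ℚ)) := by
    simp only [zsmul_eq_mul]
    field_simp
    linear_combination ((PNat.lcm m n : ℕ+) : ℚ) * h1 - h2
  rw [this]
  exact add_mem (H.1.zsmul_mem hn _) (H.1.zsmul_mem hm _)

instance : IsCofiltered H.toFunctor.Elements where
  nonempty := ⟨⟨⟨1⟩, ⟨H.2 ⟨1, by simp⟩⟩⟩⟩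
  cone_objs := by
    rintro ⟨c, ⟨x⟩⟩ ⟨d, ⟨y⟩⟩
    exact ⟨⟨⟨PNat.lcm c.val d.val⟩, ⟨H.one_div_lcm_mem x y⟩⟩,
      ⟨⟨PNat.dvd_lcm_left _ _⟩, rfl⟩, ⟨⟨PNat.dvd_lcm_right _ _⟩, rfl⟩, trivial⟩
  cone_maps := fun A B f g => ⟨A, 𝟙 A, congr_arg (𝟙 A ≫ ·) (Subtype.ext (Subsingleton.elim _ _))⟩

end SubgroupOverZ

instance : pointSubgroup.EssSurj where
  mem_essImage H := by
    obtain ⟨p, ⟨e⟩⟩ := PresheafPoint.exists_pointFiber_iso H.toFunctor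
    refine ⟨p, ⟨eqToIso (Subtype.ext (AddSubgroup.ext fun q => ?_))⟩⟩
    have h1 : q ∈ (pointSubgroup.obj p).1 ↔ (1 / (q.pnatDen : ℚ)) ∈ H.1 :=
      ⟨fun ⟨x⟩ => (e.hom.app _ x).down, fun h => ⟨e.inv.app _ ⟨h⟩⟩⟩
    rw [h1, Rat.coe_pnatDen]
    constructor
    · intro h
      have := H.1.zsmul_mem h q.num
      rwa [zsmul_eq_mul, mul_one_div, Rat.num_div_den] at this
    · intro h
      have h1 : ((Int.gcdA q.num q.den : ℤ) : ℚ) * q.num +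
          (Int.gcdB q.num q.den : ℤ) * q.den = 1 := by
        have := Int.gcd_eq_gcd_ab q.num q.den
        rw [Int.isCoprime_iff_gcd_eq_one.1 q.isCoprime_num_den] at this
        push_cast [← @Int.cast_inj ℚ] at this
        linarith
      have h2 : (1 / (q.den : ℚ)) =
          Int.gcdA q.num q.den • q + ((Int.gcdB q.num q.den : ℤ) : ℚ) := by
        have h3 : q * q.den = q.num := Rat.mul_den_eq_num q
        have h4 : (q.den : ℚ) ≠ 0 := by simp
        rw [zsmul_eq_mul, div_eq_iff h4]
        linear_combination -h1 - (Int.gcdA q.num q.den : ℚ) * h3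
      rw [h2]
      exact add_mem (H.1.zsmul_mem h _) (H.2 ⟨_, rfl⟩)

instance : pointSubgroup.IsEquivalence where

namespace RatOrdGroup

theorem exists_strictMono (A : RatOrdGroup) : ∃ f : A.carrier →+ ℚ, StrictMono f := by
  obtain ⟨K, -, ⟨e⟩⟩ := A.exists_iso
  exact ⟨K.subtype.comp (e : A.carrier →+ K), fun x y h => (OrderIso.strictMono e.toOrderIso h :)⟩

/-- An embedding in `ℚ`. -/
noncomputable def emb (A : RatOrdGroup) : A.carrier →+ ℚ := A.exists_strictMono.choose

theorem emb_strictMono (A : RatOrdGroup) : StrictMono A.emb := A.exists_strictMono.choose_spec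

theorem emb_pos_iff {A : RatOrdGroup} {x : A.carrier} : 0 < A.emb x ↔ 0 < x := by
  rw [← A.emb_strictMono.lt_iff_lt, map_zero]

theorem exists_pos (A : RatOrdGroup) : ∃ x : A.carrier, 0 < x := by
  obtain ⟨K, hK, ⟨e⟩⟩ := A.exists_iso
  obtain ⟨k, hk0⟩ := (AddSubgroup.ne_bot_iff_exists_ne_zero (H := K)).1 hK
  have h : e.symm k ≠ 0 := by simpa using hk0
  rcases lt_or_gt_of_ne h with h | h
  · exact ⟨_, neg_pos.2 h⟩
  · exact ⟨_, h⟩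

theorem exists_coprime_nsmul_eq {A : RatOrdGroup} {x y : A.carrier} (hx : 0 < x) (hy : 0 < y) :
    ∃ m n : ℕ+, Nat.Coprime m n ∧ (m : ℕ) • x = (n : ℕ) • y := by
  have hx' := emb_pos_iff.2 hx
  have hy' := emb_pos_iff.2 hy
  set q : ℚ := A.emb x / A.emb y with hq
  have hq0 : 0 < q.num := Rat.num_pos.2 (div_pos hx' hy')
  refine ⟨q.pnatDen, ⟨q.num.natAbs, Int.natAbs_pos.2 hq0.ne'⟩, q.reduced.symm, ?_⟩
  apply A.emb_strictMono.injective
  have h1 : ((q.num.natAbs : ℕ) : ℚ) = q.num := by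
    rw [← Int.cast_natCast, Int.natAbs_of_nonneg hq0.le]
  have h2 : q * q.den = q.num := Rat.mul_den_eq_num q
  have h3 : q * A.emb y = A.emb x := div_mul_cancel₀ _ hy'.ne'
  rw [map_nsmul, map_nsmul, nsmul_eq_mul, nsmul_eq_mul, Rat.coe_pnatDen, PNat.mk_coe, h1, ← h2,
    ← h3]
  ring

theorem exists_common_divisor {A : RatOrdGroup} {x y : A.carrier} (hx : 0 < x) (hy : 0 < y) :
    ∃ (z : A.carrier) (m n : ℕ+), 0 < z ∧ (m : ℕ) • z = x ∧ (n : ℕ) • z = y := by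
  obtain ⟨m, n, hmn, h⟩ := exists_coprime_nsmul_eq hx hy
  have hb : (1 : ℤ) = m * (m : ℕ).gcdA n + n * (m : ℕ).gcdB n := by
    rw [← Nat.gcd_eq_gcd_ab, hmn.gcd_eq_one]; rfl
  have h' : ((m : ℕ) : ℤ) • x = ((n : ℕ) : ℤ) • y := by simpa using h
  set a := (m : ℕ).gcdA n
  set b := (m : ℕ).gcdB n
  have hz : ((n : ℕ) : ℤ) • (a • y + b • x) = x := by
    calc ((n : ℕ) : ℤ) • (a • y + b • x)
        = a • ((n : ℕ) : ℤ) • y + (b * (n : ℕ)) • x := by module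
      _ = (m * a + n * b : ℤ) • x := by rw [← h']; module
      _ = x := by rw [← hb, one_smul]
  have hz' : ((m : ℕ) : ℤ) • (a • y + b • x) = y := by
    calc ((m : ℕ) : ℤ) • (a • y + b • x)
        = b • ((m : ℕ) : ℤ) • x + (a * (m : ℕ)) • y := by module
      _ = (m * a + n * b : ℤ) • y := by rw [h']; module
      _ = y := by rw [← hb, one_smul]
  rw [natCast_zsmul] at hz hz'
  refine ⟨a • y + b • x, n, m, ?_, hz, hz'⟩
  by_contra hneg
  exact (hz ▸ hx).not_ge (nsmul_nonpos (not_lt.1 hneg) _)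

theorem exists_hom_of_scalar {A B : RatOrdGroup} {c : ℚ} (hc : 0 < c)
    (h : ∀ x : A.carrier, 0 < x → ∃ y : B.carrier, B.emb y = c * A.emb x) :
    ∃ f : A ⟶ B, ∀ x, B.emb (f.1 x) = c * A.emb x := by
  have h' (x : A.carrier) : ∃ y : B.carrier, B.emb y = c * A.emb x := by
    rcases lt_trichotomy 0 x with hx | rfl | hx
    · exact h x hx
    · exact ⟨0, by simp⟩
    · obtain ⟨y, hy⟩ := h (-x) (neg_pos.2 hx)
      exact ⟨-y, by rw [map_neg, hy, map_neg]; ring⟩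
  choose f hf using h'
  have hinj := B.emb_strictMono.injective
  refine ⟨⟨{
    toFun := f
    map_zero' := hinj (by simp [hf])
    map_add' := ?_
    monotone' := ?_ }, ?_⟩, hf⟩
  · intro x y
    exact hinj (by rw [hf, map_add, map_add, hf, hf, mul_add])
  · intro x y hxy
    refine B.emb_strictMono.le_iff_le.1 ?_
    change B.emb (f x) ≤ B.emb (f y)
    rw [hf, hf]
    exact mul_le_mul_of_nonneg_left (A.emb_strictMono.monotone hxy) hc.le
  · intro x y hxy
    have : B.emb (f x) = B.emb (f y) := congr_arg B.emb hxy
    rw [hf, hf] at this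
    exact A.emb_strictMono.injective (mul_left_cancel₀ hc.ne' this)

theorem emb_mul_emb_eq {A B : RatOrdGroup} {x y : A.carrier} {x' y' : B.carrier} {m n : ℕ+}
    (h : (m : ℕ) • x = (n : ℕ) • y) (h' : (m : ℕ) • x' = (n : ℕ) • y') :
    B.emb x' * A.emb y = B.emb y' * A.emb x := by
  have h1 : (m : ℚ) * A.emb x = n * A.emb y := by
    simpa using congr_arg A.emb h
  have h2 : (m : ℚ) * B.emb x' = n * B.emb y' := by
    simpa using congr_arg B.emb h'
  have hm : (m : ℚ) ≠ 0 := by positivity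
  have hn : (n : ℚ) ≠ 0 := by positivity
  apply mul_left_cancel₀ (mul_ne_zero hm hn)
  linear_combination (n * A.emb y) * h2 - (n * B.emb y') * h1

/-- Isomorphic objects are isomorphic as ordered groups. -/
def orderIsoOfIso {A B : RatOrdGroup} (e : A ≅ B) : A.carrier ≃+o B.carrier where
  toFun := e.hom.1
  invFun := e.inv.1
  left_inv x := congr_arg (fun f : A ⟶ A => f.1 x) e.hom_inv_id
  right_inv x := congr_arg (fun f : B ⟶ B => f.1 x) e.inv_hom_id
  map_add' := map_add e.hom.1
  map_le_map_iff' {x y} := by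
    refine ⟨fun h => ?_, fun h => e.hom.1.monotone' h⟩
    have h' := e.inv.1.monotone' h
    have h2 (z : A.carrier) : e.inv.1 (e.hom.1 z) = z :=
      congr_arg (fun f : A ⟶ A => f.1 z) e.hom_inv_id
    simpa [h2] using h'

/-- Isomorphic ordered groups are isomorphic objects. -/
def isoOfOrderIso {A B : RatOrdGroup} (e : A.carrier ≃+o B.carrier) : A ≅ B where
  hom := ⟨e, e.injective⟩
  inv := ⟨e.symm, e.symm.injective⟩
  hom_inv_id := Subtype.ext (OrderAddMonoidHom.ext fun x => e.symm_apply_apply x)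
  inv_hom_id := Subtype.ext (OrderAddMonoidHom.ext fun x => e.apply_symm_apply x)

instance : positivePart.Faithful where
  map_injective {A B} f g h := by
    have hpos (x : A.carrier) (hx : 0 < x) : f.1 x = g.1 x := by
      have hx' := ConcreteCategory.congr_hom (NatTrans.congr_app h (SingleObj.star ℕ+))
        (⟨x, hx⟩ : {x : A.carrier // 0 < x})
      exact congr_arg Subtype.val hx'
    apply Subtype.ext
    ext x
    rcases lt_trichotomy 0 x with hx | rfl | hx
    · exact hpos x hx
    · rw [map_zero, map_zero]
    · rw [← neg_inj, ← map_neg, ← map_neg, hpos _ (neg_pos.2 hx)]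

instance : positivePart.Full where
  map_surjective {A B} φ := by
    let g : {x : A.carrier // 0 < x} → {x : B.carrier // 0 < x} := φ.app (SingleObj.star ℕ+)
    have hg (n : ℕ+) (x : {x : A.carrier // 0 < x}) :
        (g ⟨(n : ℕ) • x.1, A.smul_pos_of_pos n x.2⟩).1 = (n : ℕ) • (g x).1 :=
      congr_arg Subtype.val (NatTrans.naturality_apply φ
        (X := SingleObj.star ℕ+) (Y := SingleObj.star ℕ+) n x)
    have hratio (x y : {x : A.carrier // 0 < x}) :
        B.emb (g x).1 * A.emb y.1 = B.emb (g y).1 * A.emb x.1 := by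
      obtain ⟨m, n, -, h⟩ := exists_coprime_nsmul_eq x.2 y.2
      refine emb_mul_emb_eq h ?_
      rw [← hg, ← hg]
      exact congr_arg (fun z => (g z).1) (Subtype.ext h)
    obtain ⟨x₀, hx₀⟩ := A.exists_pos
    have h₀ := emb_pos_iff.2 hx₀
    have hscalar (x : {x : A.carrier // 0 < x}) :
        B.emb (g x).1 = B.emb (g ⟨x₀, hx₀⟩).1 / A.emb x₀ * A.emb x.1 := by
      rw [div_mul_eq_mul_div, eq_div_iff h₀.ne']
      exact hratio x ⟨x₀, hx₀⟩
    obtain ⟨f, hf⟩ := exists_hom_of_scalar (A := A) (B := B)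
      (div_pos (emb_pos_iff.2 (g ⟨x₀, hx₀⟩).2) h₀) fun x hx => ⟨_, hscalar ⟨x, hx⟩⟩
    refine ⟨f, ?_⟩
    ext ⟨⟩ x
    apply Subtype.ext
    apply B.emb_strictMono.injective
    exact (hf x.1).trans (hscalar x).symm

instance (A : RatOrdGroup) : IsCofiltered (positivePart.obj A).Elements where
  nonempty := by
    obtain ⟨x, hx⟩ := A.exists_pos
    exact ⟨⟨SingleObj.star ℕ+, ⟨x, hx⟩⟩⟩
  cone_objs := by
    rintro ⟨⟨⟩, x, hx⟩ ⟨⟨⟩, y, hy⟩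
    obtain ⟨z, m, n, hz, rfl, rfl⟩ := exists_common_divisor hx hy
    exact ⟨⟨SingleObj.star ℕ+, ⟨z, hz⟩⟩, ⟨m, rfl⟩, ⟨n, rfl⟩, trivial⟩
  cone_maps := by
    rintro ⟨⟨⟩, x, hx⟩ Y f g
    have h : ((f.1 : ℕ+) : ℕ) • x = ((g.1 : ℕ+) : ℕ) • x :=
      congr_arg Subtype.val (f.2.trans g.2.symm)
    have : f = g := Subtype.ext (PNat.eq ((nsmul_left_strictMono hx).injective h))
    exact ⟨_, 𝟙 _, by rw [this]⟩

end RatOrdGroup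

namespace CatN

variable (X : CatN ⥤ Type)

/-- The action of `ℕ^×` on the value of a functor at the single object. -/
def act (n : ℕ+) (x : X.obj (SingleObj.star ℕ+)) : X.obj (SingleObj.star ℕ+) :=
  X.map (X := SingleObj.star ℕ+) (Y := SingleObj.star ℕ+) n x

theorem act_mul (m n : ℕ+) (x : X.obj (SingleObj.star ℕ+)) :
    act X (m * n) x = act X m (act X n x) :=
  ConcreteCategory.congr_hom (X.map_comp (X := SingleObj.star ℕ+) (Y := SingleObj.star ℕ+)
    (Z := SingleObj.star ℕ+) n m) x

theorem act_comm (m n : ℕ+) (x : X.obj (SingleObj.star ℕ+)) :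
    act X m (act X n x) = act X n (act X m x) := by
  rw [← act_mul, mul_comm, act_mul]

variable [IsCofiltered X.Elements]

theorem nonempty_obj : Nonempty (X.obj (SingleObj.star ℕ+)) := by
  obtain ⟨⟨⟨⟩, x⟩⟩ := IsCofiltered.nonempty (C := X.Elements)
  exact ⟨x⟩

theorem exists_act_eq (x y : X.obj (SingleObj.star ℕ+)) :
    ∃ (z : X.obj (SingleObj.star ℕ+)) (m n : ℕ+), act X m z = x ∧ act X n z = y := by
  obtain ⟨⟨⟨⟩, z⟩, f, g, -⟩ := IsCofilteredOrEmpty.cone_objs (C := X.Elements)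
    ⟨SingleObj.star ℕ+, x⟩ ⟨SingleObj.star ℕ+, y⟩
  exact ⟨z, f.1, g.1, f.2, g.2⟩

theorem act_injective (x : X.obj (SingleObj.star ℕ+)) {m n : ℕ+} (h : act X m x = act X n x) :
    m = n := by
  let A : X.Elements := ⟨SingleObj.star ℕ+, x⟩
  let B : X.Elements := ⟨SingleObj.star ℕ+, act X n x⟩
  obtain ⟨W, k, hk⟩ := IsCofilteredOrEmpty.cone_maps (C := X.Elements)
    (CategoryOfElements.homMk A B m h) (CategoryOfElements.homMk A B n rfl)
  have : (m : ℕ+) * (k.1 : ℕ+) = n * (k.1 : ℕ+) := congr_arg Subtype.val hk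
  exact mul_right_cancel this

theorem exists_act_eq_act (x y : X.obj (SingleObj.star ℕ+)) :
    ∃ m n : ℕ+, act X m x = act X n y := by
  obtain ⟨z, m, n, rfl, rfl⟩ := exists_act_eq X x y
  exact ⟨n, m, act_comm X _ _ _⟩

/-- The ratio of two elements of a flat `ℕ^×`-set. -/
noncomputable def ratio (x₀ x : X.obj (SingleObj.star ℕ+)) : ℚ :=
  (exists_act_eq_act X x x₀).choose_spec.choose / (exists_act_eq_act X x x₀).choose

theorem ratio_eq {x₀ x : X.obj (SingleObj.star ℕ+)} {m n : ℕ+} (h : act X m x = act X n x₀) :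
    ratio X x₀ x = n / m := by
  set m' := (exists_act_eq_act X x x₀).choose
  set n' := (exists_act_eq_act X x x₀).choose_spec.choose
  have h' : act X m' x = act X n' x₀ := (exists_act_eq_act X x x₀).choose_spec.choose_spec
  have key : m * n' = m' * n := by
    apply act_injective X x₀
    rw [act_mul, ← h', act_comm, h, act_mul]
  have key' : (m : ℚ) * n' = m' * n := by exact_mod_cast congr_arg (fun k : ℕ+ => (k : ℚ)) key
  change (n' : ℚ) / m' = n / m
  have hm : (m : ℚ) ≠ 0 := by positivity
  have hm' : (m' : ℚ) ≠ 0 := by positivity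
  rw [div_eq_div_iff hm' hm]
  linear_combination key'

theorem ratio_self (x₀ : X.obj (SingleObj.star ℕ+)) : ratio X x₀ x₀ = 1 := by
  rw [ratio_eq X (rfl : act X 1 x₀ = act X 1 x₀)]
  simp

theorem ratio_pos (x₀ x : X.obj (SingleObj.star ℕ+)) : 0 < ratio X x₀ x := by
  unfold ratio
  positivity

theorem ratio_act (x₀ x : X.obj (SingleObj.star ℕ+)) (n : ℕ+) :
    ratio X x₀ (act X n x) = n * ratio X x₀ x := by
  obtain ⟨k, l, h⟩ := exists_act_eq_act X x x₀
  have h' : act X k (act X n x) = act X (n * l) x₀ := by rw [act_comm, h, act_mul]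
  rw [ratio_eq X h, ratio_eq X h']
  push_cast
  ring

theorem ratio_injective (x₀ : X.obj (SingleObj.star ℕ+)) : Function.Injective (ratio X x₀) := by
  intro x y hxy
  obtain ⟨z, m, n, rfl, rfl⟩ := exists_act_eq X x y
  rw [ratio_act, ratio_act] at hxy
  have := mul_right_cancel₀ (ratio_pos X x₀ z).ne' hxy
  rw [show m = n from PNat.eq (by exact_mod_cast this)]

/-- The subgroup of `ℚ` generated by the ratios. -/
def ratioSubgroup (x₀ : X.obj (SingleObj.star ℕ+)) : AddSubgroup ℚ where
  carrier := {q | ∃ (k : ℤ) (x : X.obj (SingleObj.star ℕ+)), q = k * ratio X x₀ x}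
  zero_mem' := ⟨0, x₀, by simp⟩
  neg_mem' := by
    rintro _ ⟨k, x, rfl⟩
    exact ⟨-k, x, by push_cast; ring⟩
  add_mem' := by
    rintro _ _ ⟨k, x, rfl⟩ ⟨l, y, rfl⟩
    obtain ⟨z, m, n, rfl, rfl⟩ := exists_act_eq X x y
    refine ⟨k * m + l * n, z, ?_⟩
    rw [ratio_act, ratio_act]
    push_cast
    ring

theorem exists_positivePart_iso :
    ∃ A : RatOrdGroup, Nonempty (RatOrdGroup.positivePart.obj A ≅ X) := by
  obtain ⟨x₀⟩ := nonempty_obj X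
  have hne : ratioSubgroup X x₀ ≠ ⊥ := by
    intro h
    have h1 : (1 : ℚ) ∈ ratioSubgroup X x₀ := ⟨1, x₀, by simp [ratio_self]⟩
    rw [h] at h1
    exact one_ne_zero (AddSubgroup.mem_bot.1 h1)
  let A : RatOrdGroup :=
      { carrier := ratioSubgroup X x₀
        exists_iso := ⟨_, hne, ⟨OrderAddMonoidIso.refl _⟩⟩ }
  let f (x : X.obj (SingleObj.star ℕ+)) : {a : ratioSubgroup X x₀ // 0 < a} :=
    ⟨⟨ratio X x₀ x, 1, x, by simp⟩, ratio_pos X x₀ x⟩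
  have hf : Function.Bijective f := by
    constructor
    · intro x y h
      exact ratio_injective X x₀ (congr_arg (fun a => (a.1 : ℚ)) h)
    · rintro ⟨⟨_, k, x, rfl⟩, h⟩
      have h' : (0 : ℚ) < k * ratio X x₀ x := h
      have hk : 0 < k := by exact_mod_cast pos_of_mul_pos_left h' (ratio_pos X x₀ x).le
      lift k to ℕ using hk.le
      obtain ⟨n, rfl⟩ : ∃ n : ℕ+, (n : ℕ) = k := ⟨⟨k, by exact_mod_cast hk⟩, rfl⟩
      refine ⟨act X n x, Subtype.ext (Subtype.ext ?_)⟩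
      change ratio X x₀ (act X n x) = (((n : ℕ) : ℤ) : ℚ) * ratio X x₀ x
      rw [ratio_act, Int.cast_natCast]
  refine ⟨A, ⟨(NatIso.ofComponents (fun _ => (Equiv.ofBijective f hf).toIso) ?_).symm⟩⟩
  rintro ⟨⟩ ⟨⟩ n
  ext x
  apply Subtype.ext
  apply Subtype.ext
  change ratio X x₀ (act X n x) = ((n : ℕ) • (f x).1 : ratioSubgroup X x₀)
  rw [ratio_act]
  simp [f]

end CatN

namespace RatOrdGroup

/-- The lift of the fiber functor to the essential image of `positivePart`. -/
noncomputable def pointFiberLift : PresheafPoint CatN ⥤ positivePart.EssImageSubcategory :=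
  ObjectProperty.lift _ (pointFiber CatN) fun p =>
    CatN.exists_positivePart_iso ((pointFiber CatN).obj p)

end RatOrdGroup

/-- The functor sending a point of the presheaf topos on `ℕ^×` to an ordered group. -/
noncomputable def pointOrdGroup : PresheafPoint CatN ⥤ RatOrdGroup :=
  RatOrdGroup.pointFiberLift ⋙ RatOrdGroup.positivePart.toEssImage.asEquivalence.inverse

/-- The fiber functor of a point is the positive part of the associated ordered group. -/
noncomputable def pointOrdGroupCompPositivePart :
    pointOrdGroup ⋙ RatOrdGroup.positivePart ≅ pointFiber CatN :=
  Functor.isoWhiskerRight (Functor.isoWhiskerLeft RatOrdGroup.pointFiberLift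
    RatOrdGroup.positivePart.toEssImage.asEquivalence.counitIso)
      (ObjectProperty.ι _)

instance : pointOrdGroup.Faithful :=
  have := Functor.Faithful.of_iso pointOrdGroupCompPositivePart.symm
  Functor.Faithful.of_comp _ RatOrdGroup.positivePart

instance : pointOrdGroup.Full :=
  have := Functor.Full.of_iso pointOrdGroupCompPositivePart.symm
  Functor.Full.of_comp_faithful _ RatOrdGroup.positivePart

instance : pointOrdGroup.EssSurj where
  mem_essImage A := by
    obtain ⟨p, ⟨e⟩⟩ := PresheafPoint.exists_pointFiber_iso (RatOrdGroup.positivePart.obj A)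
    exact ⟨p, ⟨RatOrdGroup.positivePart.preimageIso
      (pointOrdGroupCompPositivePart.app p ≪≫ e)⟩⟩

instance : pointOrdGroup.IsEquivalence where

/-- The restriction to `𝓡` of the presheaf represented by the object of `ℕ^×`. -/
abbrev rhoPresheaf : PresheafTopos CatR := rho.op ⋙ yoneda.obj (SingleObj.star ℕ+)

/-- The section of `rhoPresheaf` given by a positive integer `n`. -/
def rhoSection (c : CatR) (n : ℕ+) : yoneda.obj c ⟶ rhoPresheaf :=
  yonedaEquiv.symm (n : rho.obj c ⟶ SingleObj.star ℕ+)

theorem exists_rhoSection_eq {c : CatR} (s : yoneda.obj c ⟶ rhoPresheaf) :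
    ∃ n : ℕ+, rhoSection c n = s :=
  ⟨yonedaEquiv s, yonedaEquiv.symm_apply_apply s⟩

theorem rhoSection_injective (c : CatR) : Function.Injective (rhoSection c) :=
  (yonedaEquiv (X := c) (F := rhoPresheaf)).symm.injective

theorem map_comp_rhoSection {c d : CatR} (f : d ⟶ c) (n : ℕ+) :
    yoneda.map f ≫ rhoSection c n = rhoSection d (n * PNat.divExact d.val c.val) := by
  apply yonedaEquiv.injective
  rw [rhoSection, rhoSection, Equiv.apply_symm_apply, ← yonedaEquiv_naturality,
    Equiv.apply_symm_apply]
  rfl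

theorem rhoSection_comp_act (c : CatR) (n k : ℕ+) :
    rhoSection c n ≫ Functor.whiskerLeft rho.op
      (yoneda.map (X := SingleObj.star ℕ+) (Y := SingleObj.star ℕ+) k) = rhoSection c (k * n) := by
  apply yonedaEquiv.injective
  rw [yonedaEquiv_comp, rhoSection, rhoSection, Equiv.apply_symm_apply, Equiv.apply_symm_apply]
  rfl

theorem mul_divExact_div {c d : ℕ+} (h : c ∣ d) (n : ℕ+) :
    ((n * PNat.divExact d c : ℕ+) : ℚ) / d = n / c := by
  have h1 : (c : ℚ) * (PNat.divExact d c : ℕ+) = d := by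
    exact_mod_cast congr_arg (fun k : ℕ+ => (k : ℚ)) (PNat.mul_div_exact h)
  have hc : (c : ℚ) ≠ 0 := by positivity
  have hd : (d : ℚ) ≠ 0 := by positivity
  rw [div_eq_div_iff hd hc, ← h1]
  push_cast
  ring

namespace PresheafPoint

variable (p : PresheafPoint CatR)

theorem map_rhoSection_eq_iff {c d : CatR} (m n : ℕ+) (z : p.inverse.obj (yoneda.obj c))
    (w : p.inverse.obj (yoneda.obj d)) :
    p.inverse.map (rhoSection c m) z = p.inverse.map (rhoSection d n) w ↔
      (m : ℚ) / c.val = n / d.val := by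
  constructor
  · intro h
    obtain ⟨e, u, v, -, huv, -, -⟩ := p.exists_of_map_eq _ _ _ _ h
    rw [map_comp_rhoSection, map_comp_rhoSection] at huv
    rw [← mul_divExact_div u.down m, rhoSection_injective e huv, mul_divExact_div v.down n]
  · intro h
    obtain ⟨⟨e, y⟩, u, v, -⟩ := IsCofilteredOrEmpty.cone_objs
      (C := ((pointFiber CatR).obj p).Elements) ⟨c, z⟩ ⟨d, w⟩
    have hu : p.inverse.map (yoneda.map u.1) y = z := u.2
    have hv : p.inverse.map (yoneda.map v.1) y = w := v.2
    have huv : m * PNat.divExact e.val c.val = n * PNat.divExact e.val d.val := by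
      rw [← mul_divExact_div u.1.down m, ← mul_divExact_div v.1.down n] at h
      have he : (e.val : ℚ) ≠ 0 := by positivity
      exact PNat.eq (by exact_mod_cast (div_left_inj' he).1 h)
    rw [← hu, ← hv]
    refine (p.map_comp_apply (yoneda.map u.1) (rhoSection c m) y).symm.trans
      (Eq.trans ?_ (p.map_comp_apply (yoneda.map v.1) (rhoSection d n) y))
    rw [map_comp_rhoSection, map_comp_rhoSection, huv]

theorem exists_map_rhoSection_eq (x : p.inverse.obj rhoPresheaf) :
    ∃ (c : CatR) (n : ℕ+) (z : p.inverse.obj (yoneda.obj c)),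
      p.inverse.map (rhoSection c n) z = x := by
  obtain ⟨c, s, z, rfl⟩ := p.exists_map_eq x
  obtain ⟨n, rfl⟩ := exists_rhoSection_eq s
  exact ⟨c, n, z, rfl⟩

/-- The fraction represented by an element of the inverse image of `rhoPresheaf`. -/
noncomputable def fraction (x : p.inverse.obj rhoPresheaf) : ℚ :=
  (p.exists_map_rhoSection_eq x).choose_spec.choose / (p.exists_map_rhoSection_eq x).choose.val

theorem fraction_map (c : CatR) (n : ℕ+) (z : p.inverse.obj (yoneda.obj c)) :
    p.fraction (p.inverse.map (rhoSection c n) z) = n / c.val :=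
  (p.map_rhoSection_eq_iff _ _ _ _).1
    (p.exists_map_rhoSection_eq
      (p.inverse.map (rhoSection c n) z)).choose_spec.choose_spec.choose_spec

theorem fraction_injective : Function.Injective p.fraction := by
  intro x y h
  obtain ⟨c, m, z, rfl⟩ := p.exists_map_rhoSection_eq x
  obtain ⟨d, n, w, rfl⟩ := p.exists_map_rhoSection_eq y
  rw [fraction_map, fraction_map] at h
  exact (p.map_rhoSection_eq_iff _ _ _ _).2 h

theorem fraction_mem (x : p.inverse.obj rhoPresheaf) :
    p.fraction x ∈ (pointSubgroup.obj p).1 := by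
  obtain ⟨c, n, z, rfl⟩ := p.exists_map_rhoSection_eq x
  rw [fraction_map]
  have h : (1 / (c.val : ℚ)) ∈ (pointSubgroup.obj p).1 :=
    (CatR.one_div_mem_subgroupOfFlat_iff _ _).2 ⟨z⟩
  simpa [div_eq_mul_inv] using (pointSubgroup.obj p).1.nsmul_mem h n

theorem fraction_pos (x : p.inverse.obj rhoPresheaf) : 0 < p.fraction x := by
  unfold fraction
  positivity

/-- The element of the ordered group `H(p)` given by a fraction. -/
noncomputable def toPositivePart (x : p.inverse.obj rhoPresheaf) :
    {h : (pointSubgroup.obj p).1 // 0 < h} :=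
  ⟨⟨p.fraction x, p.fraction_mem x⟩, p.fraction_pos x⟩

theorem toPositivePart_bijective : Function.Bijective p.toPositivePart := by
  constructor
  · intro x y h
    exact p.fraction_injective (congr_arg (fun a => (a.1 : ℚ)) h)
  · rintro ⟨⟨q, ⟨z⟩⟩, hq⟩
    have hq' : 0 < q.num := Rat.num_pos.2 hq
    obtain ⟨n, hn⟩ : ∃ n : ℕ+, ((n : ℕ) : ℤ) = q.num :=
      ⟨⟨q.num.natAbs, Int.natAbs_pos.2 hq'.ne'⟩, Int.natAbs_of_nonneg hq'.le⟩
    refine ⟨p.inverse.map (rhoSection ⟨q.pnatDen⟩ n) z, Subtype.ext (Subtype.ext ?_)⟩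
    refine (p.fraction_map _ n z).trans ?_
    have hn' : (n : ℚ) = q.num := by exact_mod_cast congr_arg (Int.cast : ℤ → ℚ) hn
    rw [hn', Rat.coe_pnatDen, Rat.num_div_den]

theorem fraction_act (k : ℕ+) (x : p.inverse.obj rhoPresheaf) :
    p.fraction (p.inverse.map (Functor.whiskerLeft rho.op
      (yoneda.map (X := SingleObj.star ℕ+) (Y := SingleObj.star ℕ+) k)) x) =
      k * p.fraction x := by
  obtain ⟨c, n, z, rfl⟩ := p.exists_map_rhoSection_eq x
  rw [← p.map_comp_apply, rhoSection_comp_act, fraction_map, fraction_map]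
  push_cast
  ring

theorem fraction_naturality {p q : PresheafPoint CatR} (α : p.inverse ⟶ q.inverse)
    (x : p.inverse.obj rhoPresheaf) : q.fraction (α.app _ x) = p.fraction x := by
  obtain ⟨c, n, z, rfl⟩ := p.exists_map_rhoSection_eq x
  rw [NatTrans.naturality_apply, fraction_map, fraction_map]

end PresheafPoint

/-- The fiber functor of the image by `ρ` of a point `p` is the positive part of `H(p)`. -/
noncomputable def postcompRhoPointFiberIso :
    (presheafGeomMorphism rho).postcomp (Type) ⋙ pointFiber CatN ≅
      (pointSubgroup ⋙ SubgroupOverZ.toRatOrdGroup) ⋙ RatOrdGroup.positivePart :=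
  NatIso.ofComponents (fun p => NatIso.ofComponents
    (fun _ => (Equiv.ofBijective (PresheafPoint.toPositivePart p)
      (PresheafPoint.toPositivePart_bijective p)).toIso) (by
      rintro ⟨⟩ ⟨⟩ k
      ext x
      apply Subtype.ext
      apply Subtype.ext
      refine (PresheafPoint.fraction_act p k x).trans ?_
      change _ = (((k : ℕ) • (PresheafPoint.toPositivePart p x).1 : (pointSubgroup.obj p).1) : ℚ)
      simp [PresheafPoint.toPositivePart])) (by
    intro p q α
    ext ⟨⟩ x
    apply Subtype.ext
    apply Subtype.ext
    exact PresheafPoint.fraction_naturality α x)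

/-- On points, the geometric morphism induced by `ρ` sends a subgroup of `ℚ` to the underlying
ordered group. -/
noncomputable def postcompRhoIso :
    (presheafGeomMorphism rho).postcomp (Type) ⋙ pointOrdGroup ≅
      pointSubgroup ⋙ SubgroupOverZ.toRatOrdGroup :=
  Functor.fullyFaithfulCancelRight RatOrdGroup.positivePart
    (Functor.isoWhiskerLeft ((presheafGeomMorphism rho).postcomp (Type))
      pointOrdGroupCompPositivePart ≪≫ postcompRhoPointFiberIso)

section

open IsDedekindDomain

namespace FinAdele

/-- The valuation of a finite adele at a finite place. -/
noncomputable def valAt (a : FinAdele) (v : HeightOneSpectrum ℤ) : WithZero (Multiplicative ℤ) :=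
  Valued.v (a v)

theorem mem_zHat_iff {a : FinAdele} : a ∈ zHat ↔ ∀ v, a.valAt v ≤ 1 := Iff.rfl

theorem valAt_mul (a b : FinAdele) (v : HeightOneSpectrum ℤ) :
    (a * b).valAt v = a.valAt v * b.valAt v :=
  map_mul Valued.v (a v) (b v)

theorem valAt_one (v : HeightOneSpectrum ℤ) : valAt 1 v = 1 :=
  map_one (Valued.v (R := v.adicCompletion ℚ))

theorem valAt_algebraMap (q : ℚ) (v : HeightOneSpectrum ℤ) :
    (algebraMap ℚ FinAdele q).valAt v = v.valuation ℚ q :=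
  v.valuedAdicCompletion_eq_valuation' q

theorem mem_adeleSubgroup_iff {a : FinAdele} {q : ℚ} :
    q ∈ adeleSubgroup a ↔ ∀ v : HeightOneSpectrum ℤ, v.valuation ℚ q * a.valAt v ≤ 1 := by
  change algebraMap ℚ FinAdele q * a ∈ zHat ↔ _
  simp_rw [mem_zHat_iff, valAt_mul, valAt_algebraMap]

theorem mem_adeleSubgroup_algebraMap_mul {a : FinAdele} {c q : ℚ} :
    q ∈ adeleSubgroup (algebraMap ℚ FinAdele c * a) ↔ q * c ∈ adeleSubgroup a := by
  simp_rw [mem_adeleSubgroup_iff, valAt_mul, valAt_algebraMap, map_mul, mul_assoc]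

theorem one_mem_adeleSubgroup_iff {a : FinAdele} : 1 ∈ adeleSubgroup a ↔ a ∈ zHat := by
  simp [mem_adeleSubgroup_iff, mem_zHat_iff]

theorem valuation_int_le_one (v : HeightOneSpectrum ℤ) (n : ℤ) : v.valuation ℚ (n : ℚ) ≤ 1 := by
  simpa using v.valuation_le_one (K := ℚ) n

theorem valuation_int_eq_one_iff (v : HeightOneSpectrum ℤ) (n : ℤ) :
    v.valuation ℚ (n : ℚ) = 1 ↔ n ∉ v.asIdeal := by
  simpa using v.valuation_eq_one_iff_notMem (K := ℚ) (r := n)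

/-- A finite adele has a nonzero integral multiple in `Ẑ`. -/
theorem exists_int_mem_adeleSubgroup (a : FinAdele) :
    ∃ n : ℤ, n ≠ 0 ∧ (n : ℚ) ∈ adeleSubgroup a := by
  classical
  have hfin : {v : HeightOneSpectrum ℤ | ¬ a v ∈ v.adicCompletionIntegers ℚ}.Finite := a.2
  have hloc (v : HeightOneSpectrum ℤ) : ∃ n : ℤ, n ≠ 0 ∧ v.valuation ℚ (n : ℚ) * a.valAt v ≤ 1 := by
    obtain ⟨n, hn, h⟩ :=
      HeightOneSpectrum.adicCompletion.mul_nonZeroDivisor_mem_adicCompletionIntegers v (a v)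
    refine ⟨n, nonZeroDivisors.ne_zero hn, ?_⟩
    rw [HeightOneSpectrum.mem_adicCompletionIntegers, map_mul, mul_comm] at h
    rw [v.valuedAdicCompletion_eq_valuation] at h
    simpa [valAt] using h
  choose n hn0 hn using hloc
  refine ⟨∏ v ∈ hfin.toFinset, n v, Finset.prod_ne_zero_iff.2 fun v _ => hn0 v,
    mem_adeleSubgroup_iff.2 fun v => ?_⟩
  by_cases hv : v ∈ hfin.toFinset
  · rw [← Finset.mul_prod_erase _ _ hv, Int.cast_mul, map_mul, mul_right_comm]
    exact mul_le_one' (hn v) (valuation_int_le_one v _)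
  · have hv' : a.valAt v ≤ 1 := by
      by_contra h
      exact hv (hfin.mem_toFinset.2 h)
    exact mul_le_one' (valuation_int_le_one v _) hv'

theorem not_adeleSubgroup_le_of_valAt_lt {a b : FinAdele} {v : HeightOneSpectrum ℤ}
    (h : a.valAt v < b.valAt v) : ¬ adeleSubgroup a ≤ adeleSubgroup b := by
  have hb : b.valAt v ≠ 0 := (zero_le.trans_lt h).ne'
  obtain ⟨c, hc⟩ := v.valuation_surjective ℚ (WithZero.exp 1 * (b.valAt v)⁻¹)
  have hcb : v.valuation ℚ c * b.valAt v = WithZero.exp 1 := by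
    rw [hc, inv_mul_cancel_right₀ hb]
  have hca : v.valuation ℚ c * a.valAt v ≤ 1 := by
    have hlt : v.valuation ℚ c * a.valAt v < WithZero.exp 1 := by
      rw [← hcb]
      exact mul_lt_mul_of_pos_left h (by rw [hc]; exact zero_lt_iff.2 (by simp [hb]))
    by_cases h0 : v.valuation ℚ c * a.valAt v = 0
    · rw [h0]; exact zero_le_one
    · rw [← WithZero.exp_log h0, WithZero.exp_lt_exp] at hlt
      rw [← WithZero.exp_log h0, ← WithZero.exp_zero, WithZero.exp_le_exp]
      omega
  obtain ⟨n, hn0, hn⟩ := exists_int_mem_adeleSubgroup (algebraMap ℚ FinAdele c * a)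
  rw [mem_adeleSubgroup_algebraMap_mul] at hn
  obtain ⟨p, hp⟩ : ∃ p, v.asIdeal = Ideal.span {p} :=
    (IsPrincipalIdealRing.principal v.asIdeal).principal
  have hpp : Prime p := by
    have := v.isPrime
    rw [hp, Ideal.span_singleton_prime] at this
    · exact this
    · rintro rfl
      exact v.ne_bot (by rw [hp]; simp)
  have hfin : FiniteMultiplicity p n := FiniteMultiplicity.of_prime_left hpp hn0
  obtain ⟨m, hm, hpm⟩ := hfin.exists_eq_pow_mul_and_not_dvd
  have hvm : v.valuation ℚ (m : ℚ) = 1 := by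
    rw [valuation_int_eq_one_iff, hp, Ideal.mem_span_singleton]
    exact hpm
  intro hle
  have hmem : (m : ℚ) * c ∈ adeleSubgroup a := by
    rw [mem_adeleSubgroup_iff] at hn ⊢
    intro w
    by_cases hwv : w = v
    · subst hwv
      rwa [map_mul, hvm, one_mul]
    · have hwp : w.valuation ℚ (p : ℚ) = 1 := by
        rw [valuation_int_eq_one_iff]
        intro hpw
        refine hwv (HeightOneSpectrum.ext ?_)
        refine (v.isMaximal.eq_of_le w.isPrime.ne_top ?_).symm
        rw [hp, Ideal.span_singleton_le_iff_mem]
        exact hpw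
      have := hn w
      rwa [hm, Int.cast_mul, Int.cast_pow, map_mul, map_mul, map_pow, hwp, one_pow, one_mul,
        ← map_mul] at this
  have h1 := mem_adeleSubgroup_iff.1 (hle hmem) v
  rw [map_mul, hvm, one_mul, hcb, ← WithZero.exp_zero, WithZero.exp_le_exp] at h1
  omega

theorem adeleSubgroup_eq_iff {a b : FinAdele} :
    adeleSubgroup a = adeleSubgroup b ↔ ∀ v, a.valAt v = b.valAt v := by
  constructor
  · intro h v
    rcases lt_trichotomy (a.valAt v) (b.valAt v) with hv | hv | hv
    · exact absurd h.le (not_adeleSubgroup_le_of_valAt_lt hv)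
    · exact hv
    · exact absurd h.ge (not_adeleSubgroup_le_of_valAt_lt hv)
  · intro h
    ext q
    simp_rw [mem_adeleSubgroup_iff, h]

theorem mem_zHatUnits_iff {u : FinAdeleˣ} :
    u ∈ zHatUnits ↔ ∀ v, valAt (u : FinAdele) v = 1 := by
  have h (v : HeightOneSpectrum ℤ) :
      valAt (u : FinAdele) v * valAt ((u⁻¹ : FinAdeleˣ) : FinAdele) v = 1 := by
    rw [← valAt_mul, Units.mul_inv, valAt_one]
  rw [zHatUnits, Submonoid.mem_units_iff]
  change (u : FinAdele) ∈ zHat ∧ ((u⁻¹ : FinAdeleˣ) : FinAdele) ∈ zHat ↔ _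
  rw [mem_zHat_iff, mem_zHat_iff]
  constructor
  · rintro ⟨h1, h2⟩ v
    refine le_antisymm (h1 v) ?_
    rw [← h v]
    exact mul_le_of_le_one_right' (h2 v)
  · intro hu
    refine ⟨fun v => (hu v).le, fun v => ?_⟩
    have := h v
    rw [hu v, one_mul] at this
    exact this.le

theorem exists_zHatUnits_mul_eq {a b : FinAdele} (h : ∀ v, a.valAt v = b.valAt v) :
    ∃ u ∈ zHatUnits, (u : FinAdele) * b = a := by
  classical
  have key (a b : FinAdele) (h : ∀ v, a.valAt v = b.valAt v) (v : HeightOneSpectrum ℤ) :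
      Valued.v (if b v = 0 then 1 else a v / b v) = (1 : WithZero (Multiplicative ℤ)) := by
    split_ifs with hb
    · exact map_one _
    · rw [map_div₀]
      have h' : Valued.v (a v) = Valued.v (b v) := h v
      rw [h', div_self ((map_ne_zero _).2 hb)]
  have hzero (v : HeightOneSpectrum ℤ) : a v = 0 ↔ b v = 0 := by
    have h' : Valued.v (a v) = Valued.v (b v) := h v
    rw [← map_eq_zero (Valued.v (R := v.adicCompletion ℚ)), h', map_eq_zero]
  let f (a b : FinAdele) (h : ∀ v, a.valAt v = b.valAt v) : FinAdele :=
    ⟨fun v => if b v = 0 then 1 else a v / b v,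
      Filter.Eventually.of_forall fun v => (key a b h v).le⟩
  have hf (a b h) (v : HeightOneSpectrum ℤ) : f a b h v = if b v = 0 then 1 else a v / b v := rfl
  have hmul : f a b h * f b a (fun v => (h v).symm) = 1 := by
    refine FiniteAdeleRing.ext ℚ fun v => ?_
    change f a b h v * f b a (fun v => (h v).symm) v = 1
    rw [hf a b h, hf b a fun v => (h v).symm]
    by_cases hb : b v = 0
    · simp [hb, (hzero v).2 hb]
    · have ha : a v ≠ 0 := fun ha => hb ((hzero v).1 ha)
      simp [ha, hb]
  refine ⟨⟨f a b h, f b a fun v => (h v).symm, hmul, by rw [mul_comm, hmul]⟩, ?_, ?_⟩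
  · exact mem_zHatUnits_iff.2 fun v => key a b h v
  · refine FiniteAdeleRing.ext ℚ fun v => ?_
    change f a b h v * b v = a v
    rw [hf a b h]
    by_cases hb : b v = 0
    · simp [hb, (hzero v).2 hb]
    · simp [hb]

theorem valAt_mul_of_mem_zHatUnits {u : FinAdeleˣ} (hu : u ∈ zHatUnits) (b : FinAdele)
    (v : HeightOneSpectrum ℤ) : valAt ((u : FinAdele) * b) v = b.valAt v := by
  rw [valAt_mul, mem_zHatUnits_iff.1 hu, one_mul]

theorem toAdeleModUnits_eq_iff {a b : FinAdele} :
    toAdeleModUnits a = toAdeleModUnits b ↔ adeleSubgroup a = adeleSubgroup b := by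
  rw [adeleSubgroup_eq_iff]
  refine Quotient.eq''.trans ?_
  rw [MulAction.orbitRel_apply, MulAction.mem_orbit_iff]
  constructor
  · rintro ⟨⟨u, hu⟩, rfl⟩ v
    exact valAt_mul_of_mem_zHatUnits hu b v
  · intro h
    obtain ⟨u, hu, hab⟩ := exists_zHatUnits_mul_eq h
    exact ⟨⟨u, hu⟩, hab⟩

theorem toAdeleClass_eq_iff_exists {a b : FinAdele} :
    toAdeleClass a = toAdeleClass b ↔
      ∃ r : ℚ, 0 < r ∧ adeleSubgroup a = adeleSubgroup (algebraMap ℚ FinAdele r * b) := by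
  refine Quotient.eq''.trans ?_
  rw [MulAction.orbitRel_apply, MulAction.mem_orbit_iff]
  constructor
  · rintro ⟨⟨g, hg⟩, rfl⟩
    obtain ⟨_, ⟨r, hr, rfl⟩, u, hu, rfl⟩ := Subgroup.mem_sup.1 hg
    refine ⟨r, hr, adeleSubgroup_eq_iff.2 fun v => ?_⟩
    change valAt ((algebraMap ℚ FinAdele r * (u : FinAdele)) * b) v = _
    rw [mul_assoc, valAt_mul, valAt_mul_of_mem_zHatUnits hu, valAt_mul]
  · rintro ⟨r, hr, h⟩
    obtain ⟨u, hu, hab⟩ := exists_zHatUnits_mul_eq (adeleSubgroup_eq_iff.1 h)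
    refine ⟨⟨u * FiniteAdeleRing.unitEmbedding ℤ ℚ (Units.mk0 r hr.ne'),
      mul_mem (Subgroup.mem_sup_right hu) (Subgroup.mem_sup_left ⟨_, hr, rfl⟩)⟩, ?_⟩
    change ((u : FinAdele) * algebraMap ℚ FinAdele r) * b = a
    rw [mul_assoc, hab]

theorem exists_pos_mem_adeleSubgroup (a : FinAdele) : ∃ q : ℚ, 0 < q ∧ q ∈ adeleSubgroup a := by
  obtain ⟨n, hn, h⟩ := exists_int_mem_adeleSubgroup a
  refine ⟨|(n : ℚ)|, by positivity, ?_⟩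
  rcases abs_choice (n : ℚ) with h' | h' <;> rw [h']
  · exact h
  · exact neg_mem h

theorem mul_eq_mul_of_addMonoidHom {K L : AddSubgroup ℚ} (f : K →+ L) (x y : K) :
    (f x : ℚ) * y = f y * x := by
  have h : ((y : ℚ).num * (x : ℚ).den : ℤ) • x = ((x : ℚ).num * (y : ℚ).den : ℤ) • y := by
    apply Subtype.ext
    have hx : (x : ℚ) * (x : ℚ).den = (x : ℚ).num := Rat.mul_den_eq_num _
    have hy : (y : ℚ) * (y : ℚ).den = (y : ℚ).num := Rat.mul_den_eq_num _
    simp only [AddSubgroup.coe_zsmul, zsmul_eq_mul]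
    push_cast
    rw [← hx, ← hy]
    ring
  have h' := congr_arg (fun k => ((f k : L) : ℚ)) h
  simp only [map_zsmul, AddSubgroup.coe_zsmul, zsmul_eq_mul] at h'
  push_cast at h'
  have hx : (x : ℚ) * (x : ℚ).den = (x : ℚ).num := Rat.mul_den_eq_num _
  have hy : (y : ℚ) * (y : ℚ).den = (y : ℚ).num := Rat.mul_den_eq_num _
  have hx0 : ((x : ℚ).den : ℚ) ≠ 0 := by simp
  have hy0 : ((y : ℚ).den : ℚ) ≠ 0 := by simp
  rw [← hx, ← hy] at h'
  apply mul_left_cancel₀ (mul_ne_zero hx0 hy0)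
  linear_combination h'

theorem nonempty_orderIso_iff {a b : FinAdele} :
    Nonempty (adeleSubgroup a ≃+o adeleSubgroup b) ↔ toAdeleClass a = toAdeleClass b := by
  rw [toAdeleClass_eq_iff_exists]
  constructor
  · rintro ⟨f⟩
    obtain ⟨q, hq, hqa⟩ := exists_pos_mem_adeleSubgroup a
    let x₀ : adeleSubgroup a := ⟨q, hqa⟩
    have hpos : (0 : ℚ) < f x₀ := by
      have h0 : (0 : adeleSubgroup a) < x₀ := hq
      have := (OrderIso.strictMono f.toOrderIso h0 :)
      have h1 : f 0 < f x₀ := this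
      rw [map_zero] at h1
      exact h1
    have hscale (x : adeleSubgroup a) : (f x : ℚ) = x * (f x₀ / q) := by
      have h1 : (f x : ℚ) * q = f x₀ * x :=
        mul_eq_mul_of_addMonoidHom (f : adeleSubgroup a →+ adeleSubgroup b) x x₀
      field_simp
      linear_combination h1
    have hr : 0 < (f x₀ : ℚ) / q := div_pos hpos hq
    refine ⟨f x₀ / q, hr, ?_⟩
    ext x
    rw [mem_adeleSubgroup_algebraMap_mul]
    constructor
    · intro hx
      rw [← hscale ⟨x, hx⟩]
      exact (f _).2
    · intro hx
      have h1 := hscale (f.symm ⟨_, hx⟩)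
      rw [OrderAddMonoidIso.apply_symm_apply] at h1
      have h2 := mul_right_cancel₀ hr.ne' h1
      rw [h2]
      exact (f.symm _).2
  · rintro ⟨r, hr, h⟩
    have hmem (x : ℚ) : x ∈ adeleSubgroup a ↔ x * r ∈ adeleSubgroup b := by
      rw [h, mem_adeleSubgroup_algebraMap_mul]
    exact ⟨{
      toFun := fun x => ⟨x * r, (hmem x).1 x.2⟩
      invFun := fun y => ⟨y / r, (hmem _).2 (by rw [div_mul_cancel₀ _ hr.ne']; exact y.2)⟩
      left_inv := fun x => Subtype.ext (mul_div_cancel_right₀ _ hr.ne')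
      right_inv := fun y => Subtype.ext (div_mul_cancel₀ _ hr.ne')
      map_add' := fun x y => Subtype.ext (add_mul _ _ _)
      map_le_map_iff' := fun {x y} => mul_le_mul_iff_left₀ hr }⟩

/-- Membership in a subgroup of `ℚ` containing `ℤ` is a local condition. -/
theorem mem_of_forall_valuation_le {K : AddSubgroup ℚ} (h1 : (1 : ℚ) ∈ K) {q : ℚ}
    (h : ∀ v : HeightOneSpectrum ℤ, ∃ k ∈ K, v.valuation ℚ q ≤ v.valuation ℚ k) : q ∈ K := by
  let I : Ideal ℤ :=
    { carrier := {n | n • q ∈ K}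
      zero_mem' := by simp
      add_mem' := fun {m n} hm hn => by
        change (m + n) • q ∈ K
        rw [add_smul]
        exact add_mem hm hn
      smul_mem' := fun m n hn => by
        change (m * n) • q ∈ K
        rw [mul_smul]
        exact K.zsmul_mem hn m }
  by_contra hq
  have hI : I ≠ ⊤ := fun hI => hq (by
    have : (1 : ℤ) • q ∈ K := (Ideal.eq_top_iff_one I).1 hI
    simpa using this)
  obtain ⟨M, hM, hIM⟩ := Ideal.exists_le_maximal I hI
  have hden : (q.den : ℤ) ∈ I := by
    change (q.den : ℤ) • q ∈ K
    have := K.zsmul_mem h1 q.num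
    rw [zsmul_eq_mul, mul_one, ← Rat.den_mul_eq_num] at this
    simpa using this
  have hbot : M ≠ ⊥ := by
    rintro rfl
    have := (Submodule.mem_bot ℤ).1 (hIM hden)
    exact q.den_nz (by exact_mod_cast this)
  let v : HeightOneSpectrum ℤ := ⟨M, hM.isPrime, hbot⟩
  obtain ⟨k, hk, hqk⟩ := h v
  have hk0 : k ≠ 0 := by
    rintro rfl
    rw [map_zero] at hqk
    have : q = 0 := (map_eq_zero _).1 (le_zero_iff.1 hqk)
    exact hq (this ▸ K.zero_mem)
  obtain ⟨n, d, hnd⟩ := v.exists_primeCompl_mul_eq_of_integer (K := ℚ) (q / k) (by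
    rw [map_div₀]
    exact div_le_one_of_le₀ hqk zero_le)
  refine d.2 (hIM ?_)
  change (d : ℤ) • q ∈ K
  have : (d : ℤ) • q = n • k := by
    have hnd' : q / k * (d : ℤ) = n := by simpa using hnd
    rw [zsmul_eq_mul, zsmul_eq_mul, ← hnd']
    field_simp
  rw [this]
  exact K.zsmul_mem hk n

theorem exists_max_valuation {K : AddSubgroup ℚ} (h1 : (1 : ℚ) ∈ K) (v : HeightOneSpectrum ℤ)
    {q : ℚ} (hq : ∀ k ∈ K, v.valuation ℚ k ≤ v.valuation ℚ q) :
    ∃ k ∈ K, ∀ k' ∈ K, v.valuation ℚ k' ≤ v.valuation ℚ k := by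
  have hq0 : v.valuation ℚ q ≠ 0 := by
    have := hq 1 h1
    rw [map_one] at this
    exact (zero_lt_one.trans_le this).ne'
  obtain ⟨z, ⟨k, hk, hkz⟩, hmax⟩ := Int.exists_greatest_of_bdd
    (P := fun z => ∃ k ∈ K, v.valuation ℚ k = WithZero.exp z)
    ⟨WithZero.log (v.valuation ℚ q), by
      rintro z ⟨k, hk, hkz⟩
      rw [← WithZero.exp_le_exp, ← hkz, WithZero.exp_log hq0]
      exact hq k hk⟩
    ⟨0, 1, h1, by simp⟩
  refine ⟨k, hk, fun k' hk' => ?_⟩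
  by_cases h0 : v.valuation ℚ k' = 0
  · rw [h0]; exact zero_le
  · rw [hkz, ← WithZero.exp_log h0, WithZero.exp_le_exp]
    exact hmax _ ⟨k', hk', (WithZero.exp_log h0).symm⟩

/-- Every subgroup of `ℚ` containing `ℤ` is attached to an element of `Ẑ`. -/
theorem exists_adeleSubgroup_eq_of_one_mem {K : AddSubgroup ℚ} (h1 : (1 : ℚ) ∈ K) :
    ∃ a : FinAdele, adeleSubgroup a = K := by
  classical
  have hloc (v : HeightOneSpectrum ℤ) : ∃ x : v.adicCompletion ℚ, Valued.v x ≤ 1 ∧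
      ∀ q : ℚ, v.valuation ℚ q * Valued.v x ≤ 1 ↔ ∃ k ∈ K, v.valuation ℚ q ≤ v.valuation ℚ k := by
    by_cases hbdd : ∃ q : ℚ, ∀ k ∈ K, v.valuation ℚ k ≤ v.valuation ℚ q
    · obtain ⟨q, hq⟩ := hbdd
      obtain ⟨k, hk, hmax⟩ := exists_max_valuation h1 v hq
      have hk1 : 1 ≤ v.valuation ℚ k := by simpa using hmax 1 h1
      have hk0 : 0 < v.valuation ℚ k := zero_lt_one.trans_le hk1
      have hval : Valued.v (algebraMap ℚ FinAdele k⁻¹ v) = (v.valuation ℚ k)⁻¹ :=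
        (valAt_algebraMap _ v).trans (map_inv₀ _ _)
      refine ⟨algebraMap ℚ FinAdele k⁻¹ v, ?_, fun q => ?_⟩
      · rw [hval]
        exact inv_le_one_of_one_le₀ hk1
      · rw [hval, ← div_eq_mul_inv, div_le_one₀ hk0]
        exact ⟨fun h => ⟨k, hk, h⟩, fun ⟨k', hk', h⟩ => h.trans (hmax k' hk')⟩
    · push Not at hbdd
      refine ⟨0, by simp, fun q => ?_⟩
      obtain ⟨k, hk, h⟩ := hbdd q
      simpa using ⟨k, hk, h.le⟩
  choose x hx hxK using hloc
  let a : FinAdele := ⟨x, Filter.Eventually.of_forall hx⟩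
  refine ⟨a, AddSubgroup.ext fun q => mem_adeleSubgroup_iff.trans ?_⟩
  constructor
  · intro h
    exact mem_of_forall_valuation_le h1 fun v => (hxK v q).1 (h v)
  · intro hq v
    exact (hxK v q).2 ⟨q, hq, le_rfl⟩

/-- Every nontrivial subgroup of `ℚ` is attached to a finite adele. -/
theorem exists_adeleSubgroup_eq {K : AddSubgroup ℚ} (hK : K ≠ ⊥) :
    ∃ a : FinAdele, adeleSubgroup a = K := by
  obtain ⟨⟨q, hq⟩, hq0⟩ := (AddSubgroup.ne_bot_iff_exists_ne_zero (H := K)).1 hK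
  have hq0' : q ≠ 0 := fun h => hq0 (Subtype.ext h)
  obtain ⟨a, ha⟩ := exists_adeleSubgroup_eq_of_one_mem
    (K := K.comap (AddMonoidHom.mulRight q)) (show 1 * q ∈ K by rwa [one_mul])
  refine ⟨algebraMap ℚ FinAdele q⁻¹ * a, AddSubgroup.ext fun x => ?_⟩
  rw [mem_adeleSubgroup_algebraMap_mul, ha]
  change x * q⁻¹ * q ∈ K ↔ _
  rw [inv_mul_cancel_right₀ hq0']

end FinAdele

end

section

open FinAdele

theorem SubgroupOverZ.one_mem (H : SubgroupOverZ) : (1 : ℚ) ∈ H.1 := H.2 ⟨1, by simp⟩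

/-- A finite adele parametrizing a given subgroup `ℤ ⊂ H ⊂ ℚ`. -/
noncomputable def SubgroupOverZ.adele (H : SubgroupOverZ) : FinAdele :=
  (exists_adeleSubgroup_eq_of_one_mem H.one_mem).choose

theorem SubgroupOverZ.adeleSubgroup_adele (H : SubgroupOverZ) : adeleSubgroup H.adele = H.1 :=
  (exists_adeleSubgroup_eq_of_one_mem H.one_mem).choose_spec

theorem RatOrdGroup.exists_orderIso_adeleSubgroup (A : RatOrdGroup) :
    ∃ a : FinAdele, Nonempty (A.carrier ≃+o adeleSubgroup a) := by
  obtain ⟨K, hK, e⟩ := A.exists_iso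
  obtain ⟨a, rfl⟩ := exists_adeleSubgroup_eq hK
  exact ⟨a, e⟩

/-- A finite adele parametrizing a given ordered group. -/
noncomputable def RatOrdGroup.adele (A : RatOrdGroup) : FinAdele :=
  A.exists_orderIso_adeleSubgroup.choose

theorem RatOrdGroup.nonempty_orderIso_adele (A : RatOrdGroup) :
    Nonempty (A.carrier ≃+o adeleSubgroup A.adele) :=
  A.exists_orderIso_adeleSubgroup.choose_spec

theorem RatOrdGroup.toAdeleClass_adele_eq_iff (A : RatOrdGroup) (a : FinAdele) :
    toAdeleClass A.adele = toAdeleClass a ↔ Nonempty (A.carrier ≃+o adeleSubgroup a) := by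
  obtain ⟨e⟩ := A.nonempty_orderIso_adele
  rw [← nonempty_orderIso_iff]
  exact ⟨fun ⟨f⟩ => ⟨e.trans f⟩, fun ⟨f⟩ => ⟨e.symm.trans f⟩⟩

theorem pointSubgroup_obj_eq_iff {p q : PresheafPoint CatR} :
    pointSubgroup.obj p = pointSubgroup.obj q ↔ Nonempty (p ≅ q) :=
  ⟨fun h => ⟨pointSubgroup.preimageIso (eqToIso h)⟩,
    fun ⟨e⟩ => le_antisymm (leOfHom (pointSubgroup.map e.hom)) (leOfHom (pointSubgroup.map e.inv))⟩

/-- The class in `Ẑ / Ẑ^*` of an isomorphism class of points. -/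
noncomputable def pointClassRMap : PointClass CatR → zHatModUnits :=
  Quotient.lift (fun p => ⟨toAdeleModUnits (pointSubgroup.obj p).adele,
    Set.mem_image_of_mem _ (one_mem_adeleSubgroup_iff.1 (by
      rw [SubgroupOverZ.adeleSubgroup_adele]
      exact SubgroupOverZ.one_mem _))⟩) fun p q h => by
    rw [pointSubgroup_obj_eq_iff.2 h]

theorem pointClassRMap_eq_iff (p : PresheafPoint CatR) (a : FinAdele) :
    (pointClassRMap p.cls : AdeleModUnits) = toAdeleModUnits a ↔
      (pointSubgroup.obj p).1 = adeleSubgroup a := by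
  rw [← SubgroupOverZ.adeleSubgroup_adele]
  exact toAdeleModUnits_eq_iff

theorem pointClassRMap_bijective : Function.Bijective pointClassRMap := by
  constructor
  · rintro ⟨p⟩ ⟨q⟩ h
    apply Quotient.sound
    refine pointSubgroup_obj_eq_iff.1 (Subtype.ext ?_)
    have := (pointClassRMap_eq_iff p _).1 (congr_arg Subtype.val h)
    rwa [SubgroupOverZ.adeleSubgroup_adele] at this
  · rintro ⟨_, a, ha, rfl⟩
    let H : SubgroupOverZ := ⟨adeleSubgroup a, by
      rintro _ ⟨n, rfl⟩
      simpa using (adeleSubgroup a).zsmul_mem (one_mem_adeleSubgroup_iff.2 ha) n⟩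
    let p := pointSubgroup.objPreimage H
    have hp : pointSubgroup.obj p = H :=
      le_antisymm (leOfHom (pointSubgroup.objObjPreimageIso H).hom)
        (leOfHom (pointSubgroup.objObjPreimageIso H).inv)
    exact ⟨p.cls, Subtype.ext ((pointClassRMap_eq_iff p a).2 (congr_arg Subtype.val hp))⟩

/-- The class in `ℚ_+^× \ 𝔸_ℚ^f / Ẑ^*` of an isomorphism class of points. -/
noncomputable def pointClassNMap : PointClass CatN → AdeleClass :=
  Quotient.lift (fun p => toAdeleClass (pointOrdGroup.obj p).adele) fun p q ⟨e⟩ => by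
    obtain ⟨f⟩ := (pointOrdGroup.obj q).nonempty_orderIso_adele
    exact (RatOrdGroup.toAdeleClass_adele_eq_iff _ _).2
      ⟨(RatOrdGroup.orderIsoOfIso (pointOrdGroup.mapIso e)).trans f⟩

theorem pointClassNMap_eq_iff (p : PresheafPoint CatN) (a : FinAdele) :
    pointClassNMap p.cls = toAdeleClass a ↔
      Nonempty ((pointOrdGroup.obj p).carrier ≃+o adeleSubgroup a) :=
  RatOrdGroup.toAdeleClass_adele_eq_iff _ _

theorem adeleSubgroup_ne_bot (a : FinAdele) : adeleSubgroup a ≠ ⊥ := by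
  obtain ⟨q, hq, hqa⟩ := exists_pos_mem_adeleSubgroup a
  intro h
  rw [h] at hqa
  exact hq.ne' (AddSubgroup.mem_bot.1 hqa)

theorem pointClassNMap_bijective : Function.Bijective pointClassNMap := by
  constructor
  · rintro ⟨p⟩ ⟨q⟩ h
    apply Quotient.sound
    obtain ⟨f⟩ := (pointClassNMap_eq_iff p _).1 h
    obtain ⟨g⟩ := (pointOrdGroup.obj q).nonempty_orderIso_adele
    exact ⟨pointOrdGroup.preimageIso (RatOrdGroup.isoOfOrderIso (f.trans g.symm))⟩
  · rintro ⟨a⟩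
    let A : RatOrdGroup :=
      { carrier := adeleSubgroup a
        exists_iso := ⟨_, adeleSubgroup_ne_bot a, ⟨OrderAddMonoidIso.refl _⟩⟩ }
    exact ⟨(pointOrdGroup.objPreimage A).cls, (pointClassNMap_eq_iff _ a).2
      ⟨RatOrdGroup.orderIsoOfIso (pointOrdGroup.objObjPreimageIso A)⟩⟩

theorem pointClassNMap_postcomp (p : PresheafPoint CatR) :
    pointClassNMap (PresheafPoint.cls (((presheafGeomMorphism rho).postcomp (Type)).obj p)) =
      quotMap (pointClassRMap p.cls) := by
  let a := (pointSubgroup.obj p).adele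
  have ha : adeleSubgroup a = (pointSubgroup.obj p).1 := SubgroupOverZ.adeleSubgroup_adele _
  refine (pointClassNMap_eq_iff _ a).2 ?_
  rw [ha]
  exact ⟨RatOrdGroup.orderIsoOfIso (postcompRhoIso.app p)⟩

end

theorem mainTheorem8 :
    ∃ (eR : PresheafPoint CatR ≌ SubgroupOverZ) (eN : PresheafPoint CatN ≌ RatOrdGroup)
      (clsR : PointClass CatR ≃ zHatModUnits) (clsN : PointClass CatN ≃ AdeleClass),
      -- `eR` sends `p` to the subgroup `H` such that `1/n ∈ H` iff `p^*(y(n))` is nonempty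
      (∀ (p : PresheafPoint CatR) (n : ℕ+),
        (1 / (n : ℚ)) ∈ (eR.functor.obj p).1 ↔ Nonempty (((pointFiber CatR).obj p).obj ⟨n⟩)) ∧
      -- `eN` sends `p` to the ordered group with positive part the flat functor of `p`
      Nonempty (eN.functor ⋙ RatOrdGroup.positivePart ≅ pointFiber CatN) ∧
      -- adelic parametrization of the points, through the subgroups `H_a` of `ℚ`
      (∀ (p : PresheafPoint CatR) (a : FinAdele),
        (clsR p.cls : AdeleModUnits) = toAdeleModUnits a ↔
          (eR.functor.obj p).1 = adeleSubgroup a) ∧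
      (∀ (p : PresheafPoint CatN) (a : FinAdele),
        clsN p.cls = toAdeleClass a ↔
          Nonempty ((eN.functor.obj p).carrier ≃+o adeleSubgroup a)) ∧
      -- on points, the geometric morphism sends `H` to `H` viewed as an abstract ordered group
      Nonempty ((presheafGeomMorphism rho).postcomp (Type) ⋙ eN.functor ≅
        eR.functor ⋙ SubgroupOverZ.toRatOrdGroup) ∧
      -- on isomorphism classes of points, it is the quotient map
      (∀ p : PresheafPoint CatR,
        clsN (PresheafPoint.cls (((presheafGeomMorphism rho).postcomp (Type)).obj p)) =
          quotMap (clsR p.cls)) := by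
  refine ⟨pointSubgroup.asEquivalence, pointOrdGroup.asEquivalence,
    Equiv.ofBijective _ pointClassRMap_bijective, Equiv.ofBijective _ pointClassNMap_bijective,
    fun p n => CatR.one_div_mem_subgroupOfFlat_iff _ n, ⟨pointOrdGroupCompPositivePart⟩,
    pointClassRMap_eq_iff, pointClassNMap_eq_iff, ⟨postcompRhoIso⟩, pointClassNMap_postcomp⟩
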